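/- **Theorem 1.2.** *Conventions.* Let $D$ be $\mathbb R$, $\mathbb C$ or the quaternions $\mathbb H$, and let $n\ge 1$ be an integer. Matrices in $M_n(D)$ act on the left of the right $D$-vector space $D^n$ of column vectors, and the rank of a matrix is the right $D$-dimension of its image. An $\mathbb R$-algebra of matrices in $M_n(D)$ is a subset closed under addition, multiplication and multiplication by real scalars and containing $0$ (it is not assumed to contain the identity matrix). It is irreducible if for every nonzero $x\in D^n$ the set $\{ax : a\in\mathcal A\}$ spans $D^n$ as a right $D$-vector space. For $\mathcal A,\mathcal B\subseteq M_n(D)$ write $\mathcal A\sim\mathcal B$ if $\mathcal A=P^{-1}\mathcal B P$ for some invertible $P\in M_n(D)$. We regard $M_n(\mathbb R)\subseteq M_n(\mathbb C)\subseteq M_n(\mathbb H)$ entrywise via $\mathbb R\subseteq\mathbb C\subseteq\mathbb H$. We regard $M_m(\mathbb C)\subseteq M_{2m}(\mathbb R)$, $M_m(\mathbb H)\subseteq M_{2m}(\mathbb C)$ and $M_m(\mathbb H)\subseteq M_{4m}(\mathbb R)$ by replacing each entry by the corresponding block $$a+bi\mapsto\begin{bmatrix}a&-b\\ b&a\end{bmatrix},\qquad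 z+wj\mapsto\begin{bmatrix}z&w\\-\overline w&\overline z\end{bmatrix}\ (z,w\in\mathbb C),\qquad a+bi+cj+dk\mapsto\begin{bmatrix}a&-b&c&-d\\ b&a&d&c\\ -c&-d&a&b\\ d&-c&-b&a\end{bmatrix}.$$ Let $\mathcal A$ be an irreducible $\mathbb R$-algebra of matrices in $M_n(D)$. Then $\mathcal A$ contains a matrix of nonzero rank; let $r$ be the smallest nonzero rank of a matrix in $\mathcal A$. (i) If $D=\mathbb R$, then $r$ divides $n$ and $r\in\{1,2,4\}$. Moreover $\mathcal A=M_n(\mathbb R)$ if $r=1$, $\mathcal A\sim M_{n/2}(\mathbb C)$ if $r=2$, and $\mathcal A\sim M_{n/4}(\mathbb H)$ if $r=4$. In particular, $\mathcal A=M_n(\mathbb R)$ if and only if $r=1$. (ii) If $D=\mathbb C$, then $r$ divides $n$ and $r\in\{1,2\}$. Moreover $\mathcal A=M_n(\mathbb C)$ or $\mathcal A\sim M_n(\mathbb R)$ if $r=1$, and $\mathcal A\sim M_{n/2}(\mathbb H)$ if $r=2$. (iii) If $D=\mathbb H$, then $r=1$, and $\mathcal A=M_n(\mathbb H)$, $\mathcal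 A\sim M_n(\mathbb C)$ or $\mathcal A\sim M_n(\mathbb R)$. -/

import Mathlib

open scoped Matrix Quaternion

namespace BurnsideType

/-- The rank of a square matrix over a (possibly noncommutative) ring `D`, acting on the left of
the right `D`-module `Dⁿ` of column vectors: the right dimension of its image.
A right `D`-module is a module over `Dᵐᵒᵖ`. -/
noncomputable def rightRank {D : Type*} [Ring D] {n : ℕ} (a : Matrix (Fin n) (Fin n) D) : ℕ :=
  Module.finrank Dᵐᵒᵖ (Submodule.span Dᵐᵒᵖ (Set.range fun x : Fin n → D => a *ᵥ x))

/-- A family `F` of matrices in `M_n(D)` is irreducible if the orbit of every nonzero column vector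
under the multiplicative semigroup generated by `F` spans the right `D`-module `Dⁿ`. -/
def IsIrreducibleFamily {D : Type*} [Ring D] {n : ℕ} (F : Set (Matrix (Fin n) (Fin n) D)) : Prop :=
  ∀ x : Fin n → D, x ≠ 0 →
    Submodule.span Dᵐᵒᵖ
      ((fun a : Matrix (Fin n) (Fin n) D => a *ᵥ x) ''
        (Subsemigroup.closure F : Set (Matrix (Fin n) (Fin n) D))) = ⊤

/-- The nonzero ranks of the members of a family of matrices. -/
def nonzeroRanks {D : Type*} [Ring D] {n : ℕ} (F : Set (Matrix (Fin n) (Fin n) D)) : Set ℕ :=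
  {k | k ≠ 0 ∧ ∃ a ∈ F, rightRank a = k}

/-- Two sets of matrices are similar if `𝒜 = P⁻¹ ℬ P` for some invertible matrix `P`. -/
def IsSimilar {D : Type*} [Ring D] {n : ℕ} (𝒜 ℬ : Set (Matrix (Fin n) (Fin n) D)) : Prop :=
  ∃ P : (Matrix (Fin n) (Fin n) D)ˣ,
    𝒜 = (fun B : Matrix (Fin n) (Fin n) D =>
      (↑P⁻¹ : Matrix (Fin n) (Fin n) D) * B * (P : Matrix (Fin n) (Fin n) D)) '' ℬ

/-- The standard representation of `ℂ` in `M₂(ℝ)`. -/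
def complexToReal (z : ℂ) : Matrix (Fin 2) (Fin 2) ℝ :=
  !![z.re, -z.im;
     z.im, z.re]

/-- The standard representation of `ℍ` in `M₂(ℂ)`: writing `q = z + w j` with
`z = a + b i`, `w = c + d i`, the matrix is `[z, w; -conj w, conj z]`. -/
def quaternionToComplex (q : ℍ[ℝ]) : Matrix (Fin 2) (Fin 2) ℂ :=
  !![⟨q.re, q.imI⟩, ⟨q.imJ, q.imK⟩;
     -(starRingEnd ℂ ⟨q.imJ, q.imK⟩), starRingEnd ℂ ⟨q.re, q.imI⟩]

/-- The standard representation of `ℍ` in `M₄(ℝ)`. -/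
def quaternionToReal (q : ℍ[ℝ]) : Matrix (Fin 4) (Fin 4) ℝ :=
  !![q.re, -q.imI, q.imJ, -q.imK;
     q.imI, q.re, q.imK, q.imJ;
     -q.imJ, -q.imK, q.re, q.imI;
     q.imK, -q.imJ, -q.imI, q.re]

/-- For `f : E → M_d(D)` and `n = m d`, the `n × n` matrix over `D` obtained from an `m × m` matrix
`Z` over `E` by replacing each entry `Z k l` with the `d × d` block `f (Z k l)`. -/
def blockMatrix {D E : Type*} {m d n : ℕ} (h : n = m * d) (f : E → Matrix (Fin d) (Fin d) D)
    (Z : Matrix (Fin m) (Fin m) E) : Matrix (Fin n) (Fin n) D :=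
  Matrix.of fun i j =>
    f (Z (Fin.cast h i).divNat (Fin.cast h j).divNat)
      (Fin.cast h i).modNat (Fin.cast h j).modNat

end BurnsideType

/-! View `Dⁿ` as a real vector space `V`, so that `A` is an algebra of real endomorphisms commuting
with right multiplication by `D`. Let `C` be the commutant of `A` in all real endomorphisms, and `Z`
its right-linear part. Irreducibility leaves no nontrivial real subspace stable under both `A` and
`D`, and no nonzero vector killed by `A`. Then `V` is semisimple over the unital hull of `A`, and
Jacobson density yields the double centralizer property: `A` consists of the matrices commuting with
`C` (`mem_of_commute_centralizer`). It remains to determine `C` and recognise its commutant.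

By Schur `Z` has no zero divisors, so Frobenius makes it `ℝ`, `ℂ` or `ℍ`. For `D = ℝ`, `C = Z`. For
`D = ℍ`, `C` is generated by `Z` and right multiplication by `i` and `j`
(`commute_of_commute_centralizer`). For `D = ℂ`, with `I` right multiplication by `i`, one has `Z =
ℝ[I]`, and `C` is either `ℝ[I]` or `ℝ[I] + ℝ[I]K` with `K` conjugate-linear and `K² = ±1`
(`eq_or_exists_anticommute`).

Each standard form is likewise the commutant of explicit operators with the same relations. A
right-linear automorphism carrying one set of operators to the other supplies the similarity. It
comes either from the uniqueness of a representation of a division algebra in a given dimension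
(`exists_intertwining`), or from a basis of eigenvectors (`exists_linearEquiv_of_span_eq_top`).

For the ranks: if a division algebra `E` commutes with `a ≠ 0`, the image of `a` contains a copy of
`E`, so `dim E ≤ dim D · rank a`. A matrix with a single identity block, or a single diagonal matrix
unit, attains the minimum. -/

open scoped Matrix Quaternion

namespace BurnsideType

/-! ### Frobenius' theorem and generators of commutants -/

section Frobenius

variable {E : Type*} [Ring E] [Algebra ℝ E]

/-- In a finite-dimensional real algebra without zero divisors, every element lies in `ℝ` or
in a copy of `ℂ`. -/
theorem exists_eq_smul_one_add_smul [Module.Finite ℝ E] {Z : Subalgebra ℝ E}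
    (hZ : ∀ x ∈ Z, ∀ y ∈ Z, x * y = 0 → x = 0 ∨ y = 0) {x : E} (hx : x ∈ Z) :
    (∃ a : ℝ, x = a • 1) ∨
      ∃ J ∈ Z, J * J = -1 ∧ ∃ a b : ℝ, b ≠ 0 ∧ x = a • 1 + b • J := by
  obtain hE | hE := subsingleton_or_nontrivial E
  · exact Or.inl ⟨0, Subsingleton.elim _ _⟩
  have : NoZeroDivisors Z := ⟨fun {a b} h => by
    have := hZ a a.2 b b.2 (by simpa using congrArg Subtype.val h)
    simpa using this⟩
  have : IsDomain Z := NoZeroDivisors.to_isDomain Z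
  have hint : IsIntegral ℝ (⟨x, hx⟩ : Z) := Algebra.IsIntegral.isIntegral _
  have hirr := minpoly.irreducible hint
  have hp := Polynomial.eq_quadratic_of_degree_le_two hirr.degree_le_two
  have haev := minpoly.aeval ℝ (⟨x, hx⟩ : Z)
  set p := minpoly ℝ (⟨x, hx⟩ : Z) with hpdef
  set a := p.coeff 2
  set b := p.coeff 1
  set c := p.coeff 0
  have key : a • (x * x) + b • x + c • (1 : E) = 0 := by
    rw [hp] at haev
    have := congrArg Subtype.val haev
    simpa [Algebra.smul_def, pow_two] using this
  by_cases ha : a = 0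
  · left
    by_cases hb : b = 0
    · have hc : c = 0 := by
        simpa [ha, hb] using key
      exact absurd (by rw [hp, ha, hb, hc]; simp) hirr.ne_zero
    · refine ⟨-(c / b), ?_⟩
      rw [ha, zero_smul, zero_add] at key
      have : b • x = -(c • (1 : E)) := eq_neg_of_add_eq_zero_left key
      calc x = b⁻¹ • (b • x) := by rw [smul_smul, inv_mul_cancel₀ hb, one_smul]
        _ = _ := by rw [this, smul_neg, smul_smul, neg_smul]; congr 2; field_simp
  -- Complete the square: `y * y = δ`. If `δ ≥ 0` this factors and `y` is real; if `δ < 0`,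
  -- rescaling `y` gives the square root of `-1`.
  · set y : E := x + (b / (2 * a)) • 1 with hy
    have hyZ : y ∈ Z := Z.add_mem hx (Z.smul_mem Z.one_mem _)
    set δ : ℝ := (b / (2 * a)) ^ 2 - c / a with hδ
    have hxx : x * x = -(b / a) • x - (c / a) • (1 : E) := by
      have : x * x = a⁻¹ • (a • (x * x)) := by rw [smul_smul, inv_mul_cancel₀ ha, one_smul]
      rw [this, show a • (x * x) = -(b • x) - c • (1 : E) by
        rw [← sub_eq_zero, ← key]; abel]
      rw [smul_sub, smul_neg, smul_smul, smul_smul, neg_smul]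
      congr 2 <;> ring_nf
    have hyy : y * y = δ • 1 := by
      rw [hy, hδ]
      simp only [add_mul, mul_add, hxx, smul_mul_assoc, mul_smul_comm, one_mul, mul_one]
      match_scalars <;> field_simp <;> ring
    have hxy : x = y - (b / (2 * a)) • 1 := by rw [hy]; abel
    rcases le_or_gt 0 δ with h0 | h0
    · left
      have hs : (y - (Real.sqrt δ) • 1) * (y + (Real.sqrt δ) • 1) = 0 := by
        simp only [sub_mul, mul_add, hyy, smul_mul_assoc, mul_smul_comm, one_mul, mul_one]
        have := Real.mul_self_sqrt h0
        match_scalars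
        · linear_combination -this
        · ring
      rcases hZ _ (Z.sub_mem hyZ (Z.smul_mem Z.one_mem _)) _
        (Z.add_mem hyZ (Z.smul_mem Z.one_mem _)) hs with h | h
      · exact ⟨Real.sqrt δ - b / (2 * a), by rw [hxy, sub_eq_zero.mp h, sub_smul]⟩
      · exact ⟨-Real.sqrt δ - b / (2 * a), by
          rw [hxy, eq_neg_of_add_eq_zero_left h, sub_smul, neg_smul]⟩
    · right
      have hs : Real.sqrt (-δ) ≠ 0 := (Real.sqrt_pos.mpr (by linarith)).ne'
      refine ⟨(Real.sqrt (-δ))⁻¹ • y, Z.smul_mem hyZ _, ?_, -(b / (2 * a)), Real.sqrt (-δ), hs, ?_⟩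
      · rw [smul_mul_smul_comm, hyy, smul_smul, ← mul_inv, Real.mul_self_sqrt (by linarith)]
        rw [inv_neg, neg_mul, inv_mul_cancel₀ h0.ne, neg_smul, one_smul]
      · rw [smul_smul, mul_inv_cancel₀ hs, one_smul, hxy, neg_smul]; abel

/-- In a real division algebra, the commutant of a square root `J` of `-1` is `ℝ[J]`. -/
theorem exists_eq_of_commute [Module.Finite ℝ E] {Z : Subalgebra ℝ E}
    (hZ : ∀ x ∈ Z, ∀ y ∈ Z, x * y = 0 → x = 0 ∨ y = 0) {J : E} (hJ : J ∈ Z) (hJJ : J * J = -1)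
    {x : E} (hx : x ∈ Z) (hc : Commute x J) : ∃ a b : ℝ, x = a • 1 + b • J := by
  rcases exists_eq_smul_one_add_smul hZ hx with ⟨a, rfl⟩ | ⟨K, hK, hKK, a, b, hb, rfl⟩
  · exact ⟨a, 0, by simp⟩
  · have hKJ : K * J = J * K := by
      have h : b • (K * J) = b • (J * K) := by
        have := hc.eq
        simpa [add_mul, mul_add] using this
      exact smul_right_injective E hb h
    -- Two commuting square roots of `-1` differ by a sign when there are no zero divisors.
    have h0 : (K - J) * (K + J) = 0 := by
      rw [sub_mul, mul_add, mul_add, hKK, hJJ, hKJ]; abel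
    rcases hZ _ (Z.sub_mem hK hJ) _ (Z.add_mem hK hJ) h0 with h | h
    · exact ⟨a, b, by rw [sub_eq_zero.mp h]⟩
    · exact ⟨a, -b, by rw [eq_neg_of_add_eq_zero_left h, smul_neg, neg_smul]⟩

/-- A subalgebra containing a square root `J` of `-1` whose commutant is `ℝ[J]` is `ℝ[J]` or is
generated by `J` and an element `K` anticommuting with `J` and with square `±1`. -/
theorem eq_or_exists_anticommute {C : Subalgebra ℝ E} {J : E} (hJ : J ∈ C) (hJJ : J * J = -1)
    (hcomm : ∀ x ∈ C, Commute x J → ∃ a b : ℝ, x = a • 1 + b • J)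
    (hanti : ∀ x ∈ C, x * J = -(J * x) → x * x = 0 → x = 0) :
    (∀ f, Commute f J → ∀ c ∈ C, Commute f c) ∨
      ∃ K ∈ C, K * J = -(J * K) ∧ (K * K = 1 ∨ K * K = -1) ∧
        ∀ f, Commute f J → Commute f K → ∀ c ∈ C, Commute f c := by
  have hJ1 : ∀ x, J * (J * x) = -x := fun x => by rw [← mul_assoc, hJJ, neg_one_mul]
  -- Conjugation by `J` is the involution `x ↦ -JxJ`; `u` and `v` are the components of `x` in its
  -- `±1` eigenspaces.
  have split : ∀ x ∈ C, ∃ u ∈ C, ∃ v ∈ C, Commute u J ∧ v * J = -(J * v) ∧ x = u + v := by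
    intro x hx
    have hm : J * x * J ∈ C := C.mul_mem (C.mul_mem hJ hx) hJ
    refine ⟨(2⁻¹ : ℝ) • (x - J * x * J), C.smul_mem (C.sub_mem hx hm) _,
      (2⁻¹ : ℝ) • (x + J * x * J), C.smul_mem (C.add_mem hx hm) _, ?_, ?_, ?_⟩
    · rw [commute_iff_eq]
      simp only [smul_mul_assoc, mul_smul_comm, sub_mul, mul_sub, mul_assoc, hJJ, hJ1]
      simp only [mul_neg, mul_one]
      congr 1; abel
    · simp only [smul_mul_assoc, mul_smul_comm, add_mul, mul_add, mul_assoc, hJJ, hJ1]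
      simp only [mul_neg, mul_one, ← smul_neg]
      congr 1; abel
    · module
  by_cases h : ∀ x ∈ C, x * J = -(J * x) → x = 0
  · left
    intro f hf c hc
    obtain ⟨u, hu, v, hv, huJ, hvJ, rfl⟩ := split c hc
    obtain ⟨a, b, rfl⟩ := hcomm u hu huJ
    rw [h v hv hvJ, add_zero]
    exact ((Commute.one_right f).smul_right a).add_right (hf.smul_right b)
  · right
    push Not at h
    obtain ⟨K, hK, hKJ, hK0⟩ := h
    have hKc : ∀ x, x * J = -(J * x) → Commute (x * K) J := by
      intro x hx
      rw [commute_iff_eq, mul_assoc, hKJ, mul_neg, ← mul_assoc, hx, neg_mul, neg_neg, mul_assoc]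
    obtain ⟨a, b, hab⟩ := hcomm _ (C.mul_mem hK hK) (hKc K hKJ)
    -- `K²` commutes with `K` while `JK = -KJ`, so `K²` has no `J`-component.
    have hb : b = 0 := by
      by_contra hb
      have h1 : K * (K * K) = (K * K) * K := (mul_assoc _ _ _).symm
      rw [hab] at h1
      simp only [mul_add, add_mul, mul_smul_comm, smul_mul_assoc, mul_one, one_mul, hKJ] at h1
      have h2 : (2 * b) • (J * K) = 0 := by
        have := add_left_cancel h1
        rw [smul_neg] at this
        rw [two_mul, add_smul]
        nth_rewrite 1 [← this]
        abel
      have h3 : J * K = 0 := (smul_eq_zero.mp h2).resolve_left (by simpa using hb)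
      apply hK0
      have := hJ1 K
      rw [h3, mul_zero] at this
      exact neg_eq_zero.mp this.symm
    rw [hb, zero_smul, add_zero] at hab
    have ha : a ≠ 0 := by
      rintro rfl
      exact hK0 (hanti K hK hKJ (by rw [hab, zero_smul]))
    have hs : Real.sqrt |a| ≠ 0 := (Real.sqrt_pos.mpr (abs_pos.mpr ha)).ne'
    refine ⟨(Real.sqrt |a|)⁻¹ • K, C.smul_mem hK _, ?_, ?_, ?_⟩
    · rw [smul_mul_assoc, hKJ, mul_smul_comm, smul_neg]
    · rw [smul_mul_smul_comm, hab, smul_smul, ← mul_inv, Real.mul_self_sqrt (abs_nonneg a)]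
      rcases lt_or_gt_of_ne ha with h | h
      · right; rw [abs_of_neg h, inv_neg, neg_mul, inv_mul_cancel₀ ha, neg_smul, one_smul]
      · left; rw [abs_of_pos h, inv_mul_cancel₀ ha, one_smul]
    · intro f hf hfK c hc
      have hfK : Commute f K := by
        have := hfK.smul_right (Real.sqrt |a|)
        rwa [smul_smul, mul_inv_cancel₀ hs, one_smul] at this
      obtain ⟨u, hu, v, hv, huJ, hvJ, rfl⟩ := split c hc
      have hlin : ∀ a b : ℝ, Commute f (a • 1 + b • J) := fun a b =>
        ((Commute.one_right f).smul_right a).add_right (hf.smul_right b)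
      obtain ⟨c, d, hcd⟩ := hcomm _ (C.mul_mem hv hK) (hKc v hvJ)
      -- `vK` commutes with `J`, hence lies in `ℝ[J]`; thus `C = ℝ[J] + ℝ[J]K`.
      have hv' : v = a⁻¹ • ((v * K) * K) := by
        rw [mul_assoc, hab, mul_smul_comm, mul_one, smul_smul, inv_mul_cancel₀ ha, one_smul]
      obtain ⟨c', d', hcd'⟩ := hcomm u hu huJ
      rw [hv', hcd, hcd']
      exact (hlin _ _).add_right (((hlin c d).mul_right hfK).smul_right _)

/-- **Frobenius' theorem**: a finite-dimensional real algebra without zero divisors is `ℝ`, `ℂ`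
or `ℍ`, phrased in terms of generators. -/
theorem frobenius [Module.Finite ℝ E] {Z : Subalgebra ℝ E}
    (hZ : ∀ x ∈ Z, ∀ y ∈ Z, x * y = 0 → x = 0 ∨ y = 0) :
    (∀ f : E, ∀ c ∈ Z, Commute f c) ∨
      (∃ J ∈ Z, J * J = -1 ∧ ∀ f, Commute f J → ∀ c ∈ Z, Commute f c) ∨
      ∃ J ∈ Z, ∃ K ∈ Z, J * J = -1 ∧ K * K = -1 ∧ K * J = -(J * K) ∧
        ∀ f, Commute f J → Commute f K → ∀ c ∈ Z, Commute f c := by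
  by_cases h : ∀ x ∈ Z, ∃ a : ℝ, x = a • 1
  · left
    intro f c hc
    obtain ⟨a, rfl⟩ := h c hc
    exact (Commute.one_right f).smul_right a
  right
  push Not at h
  obtain ⟨x, hx, hxa⟩ := h
  obtain ⟨a, rfl⟩ | ⟨J, hJ, hJJ, -⟩ := exists_eq_smul_one_add_smul hZ hx
  · exact absurd rfl (hxa a)
  rcases eq_or_exists_anticommute hJ hJJ (fun x hx => exists_eq_of_commute hZ hJ hJJ hx)
    (fun x hx _ h => by simpa using hZ x hx x hx h) with h | ⟨K, hK, hKJ, hKK, h⟩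
  · exact Or.inl ⟨J, hJ, hJJ, h⟩
  · refine Or.inr ⟨J, hJ, K, hK, hJJ, ?_, hKJ, h⟩
    refine hKK.resolve_left fun hKK => ?_
    have h0 : (K - 1) * (K + 1) = 0 := by rw [sub_mul, mul_add, hKK]; simp [add_comm]
    -- `K² = 1` would make `K = ±1`; a scalar anticommuting with `J` is zero, forcing `1 = 0`.
    have : ∀ ε : ℝ, K = ε • 1 → x = (0 : ℝ) • (1 : E) := by
      rintro ε rfl
      rw [smul_mul_assoc, one_mul, mul_smul_comm, mul_one] at hKJ
      have h2 : (2 : ℝ) • (ε • J) = 0 := by rw [two_smul]; nth_rewrite 1 [hKJ]; abel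
      have h3 : ε • J = 0 := (smul_eq_zero.mp h2).resolve_left two_ne_zero
      have h4 : ε • (1 : E) = 0 := by
        have := congrArg (· * J) h3
        simpa [hJJ] using this
      have h5 : (1 : E) = 0 := by rw [← hKK, h4, mul_zero]
      rw [← mul_one x, h5, mul_zero, smul_zero]
    rcases hZ _ (Z.sub_mem hK Z.one_mem) _ (Z.add_mem hK Z.one_mem) h0 with h | h
    · exact hxa _ (this 1 (by rw [one_smul, sub_eq_zero.mp h]))
    · exact hxa _ (this (-1) (by rw [neg_smul, one_smul, eq_neg_of_add_eq_zero_left h]))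

/-- If a subalgebra contains anticommuting square roots `I`, `J` of `-1`, then it is generated by
`I`, `J` and their joint commutant. -/
theorem commute_of_commute_centralizer {C : Subalgebra ℝ E} {I J : E} (hI : I ∈ C) (hJ : J ∈ C)
    (hII : I * I = -1) (hJJ : J * J = -1) (hJI : J * I = -(I * J)) {f : E} (hfI : Commute f I)
    (hfJ : Commute f J) (hf : ∀ c ∈ C, Commute c I → Commute c J → Commute f c) :
    ∀ c ∈ C, Commute f c := by
  -- The last clause says that splitting by one root preserves commutation with any `y` that
  -- commutes or anticommutes with it. This allows splitting by `J` without losing commutation with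
  -- `I`.
  have split : ∀ I ∈ C, I * I = -1 → ∀ x ∈ C, ∃ u ∈ C, ∃ v ∈ C,
      Commute u I ∧ v * I = -(I * v) ∧ x = u + v ∧ ∀ y, Commute x y → y * I = I * y ∨
        y * I = -(I * y) → Commute u y ∧ Commute v y := by
    intro I hI hII x hx
    have hI1 : ∀ x, I * (I * x) = -x := fun x => by rw [← mul_assoc, hII, neg_one_mul]
    have hm : I * x * I ∈ C := C.mul_mem (C.mul_mem hI hx) hI
    refine ⟨(2⁻¹ : ℝ) • (x - I * x * I), C.smul_mem (C.sub_mem hx hm) _,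
      (2⁻¹ : ℝ) • (x + I * x * I), C.smul_mem (C.add_mem hx hm) _, ?_, ?_, ?_, ?_⟩
    · rw [commute_iff_eq]
      simp only [smul_mul_assoc, mul_smul_comm, sub_mul, mul_sub, mul_assoc, hII, hI1]
      simp only [mul_neg, mul_one]
      congr 1; abel
    · simp only [smul_mul_assoc, mul_smul_comm, add_mul, mul_add, mul_assoc, hII, hI1]
      simp only [mul_neg, mul_one, ← smul_neg]
      congr 1; abel
    · module
    · intro y hxy hy
      have : Commute (I * x * I) y := by
        have hxy' : y * x = x * y := hxy.eq.symm
        rw [commute_iff_eq]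
        rcases hy with hy | hy
        · rw [mul_assoc, ← hy, ← mul_assoc, mul_assoc I, ← hxy', ← mul_assoc, ← hy]
          simp only [mul_assoc]
        · have hy' : I * y = -(y * I) := by rw [hy, neg_neg]
          rw [mul_assoc, hy', mul_neg, ← mul_assoc, mul_assoc I, ← hxy', ← mul_assoc, hy']
          simp only [mul_assoc, neg_mul, neg_neg]
      exact ⟨(hxy.sub_left this).smul_left _, (hxy.add_left this).smul_left _⟩
  have hIinv : ∀ x, x * I * I = -x := fun x => by rw [mul_assoc, hII, mul_neg_one]
  have hJinv : ∀ x, x * J * J = -x := fun x => by rw [mul_assoc, hJJ, mul_neg_one]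
  have step : ∀ c ∈ C, Commute c I → Commute f c := by
    intro c hc hcI
    obtain ⟨u, hu, v, hv, huJ, hvJ, rfl, hc'⟩ := split J hJ hJJ c hc
    obtain ⟨huI, hvI⟩ := hc' I hcI (Or.inr (by rw [hJI, neg_neg]))
    refine (hf u hu huI huJ).add_right ?_
    -- Both `v` and `I` anticommute with `J`, so `vI` lies in the joint commutant; `v` is recovered
    -- as `-(vI)I`.
    have h1 : Commute f (v * I) := by
      refine hf _ (C.mul_mem hv hI) (hvI.mul_left (Commute.refl I)) ?_
      rw [commute_iff_eq, mul_assoc, show I * J = -(J * I) by rw [hJI, neg_neg], mul_neg,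
        ← mul_assoc, hvJ, neg_mul, neg_neg, mul_assoc]
    have := h1.mul_right hfI
    rw [hIinv] at this
    simpa using this.neg_right
  intro c hc
  obtain ⟨u, hu, v, hv, huI, hvI, rfl, -⟩ := split I hI hII c hc
  refine (step u hu huI).add_right ?_
  have h1 : Commute f (v * J) := by
    refine step _ (C.mul_mem hv hJ) ?_
    rw [commute_iff_eq, mul_assoc, hJI, mul_neg, ← mul_assoc, hvI, neg_mul, neg_neg, mul_assoc]
  have := h1.mul_right hfJ
  rw [hJinv] at this
  simpa using this.neg_right

end Frobenius

/-! ### Semisimplicity and the double centralizer theorem -/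

section DoubleCentralizer

variable {V : Type*} [AddCommGroup V] [Module ℝ V] [Module.Finite ℝ V]

/-- A finite-dimensional module over a real algebra `R` is semisimple if it has no
nontrivial submodule stable under a family `S` of `R`-linear maps. -/
theorem isSemisimpleModule_of_stable {R : Type*} [Ring R] [Algebra ℝ R] [Module R V]
    [IsScalarTower ℝ R V] (S : Set (V →ₗ[R] V))
    (hS : ∀ W : Submodule R V, (∀ s ∈ S, ∀ w ∈ W, s w ∈ W) → W = ⊥ ∨ W = ⊤) :
    IsSemisimpleModule R V := by
  obtain hV | hV := subsingleton_or_nontrivial V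
  · exact { exists_isCompl := fun W => ⟨⊤, Subsingleton.elim ⊥ W ▸ isCompl_bot_top⟩ }
  have : IsArtinian R V := isArtinian_of_tower ℝ inferInstance
  obtain ⟨N, hN⟩ := IsAtomic.exists_atom (Submodule R V)
  have hNs : IsSimpleModule R N := isSimpleModule_iff_isAtom.mpr hN
  -- The sum of all endomorphic images of a simple `N` is carried into itself by every endomorphism,
  -- in particular by `S`. Each image is a quotient of `N`, hence semisimple.
  have key : (⨆ g : V →ₗ[R] V, N.map g) = ⊤ := by
    set U : Submodule R V := ⨆ g : V →ₗ[R] V, N.map g with hU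
    have hNU : N ≤ U := by
      simpa using le_iSup (fun g : V →ₗ[R] V => N.map g) LinearMap.id
    refine (hS U fun s hs w hw => ?_).resolve_left fun h => hN.1 (le_bot_iff.mp (h ▸ hNU))
    have hmap : U.map s ≤ U := by
      rw [hU, Submodule.map_iSup]
      refine iSup_le fun g => ?_
      rw [← Submodule.map_comp]
      exact le_iSup (fun g : V →ₗ[R] V => N.map g) (s ∘ₗ g)
    exact hmap (Submodule.mem_map_of_mem (f := s) hw)
  refine isSemisimpleModule_of_isSemisimpleModule_submodule' (fun g => ?_) key
  have := IsSemisimpleModule.range (g ∘ₗ N.subtype)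
  rwa [LinearMap.range_comp, Submodule.range_subtype] at this

/-- **Double centralizer theorem** for a not necessarily unital algebra `A` of endomorphisms acting
without annihilated vectors, such that no nontrivial subspace is stable under `A` and a family `S`
of maps commuting with `A`. -/
theorem mem_of_commute_centralizer (A : NonUnitalSubalgebra ℝ (Module.End ℝ V))
    (S : Set (Module.End ℝ V)) (hAS : ∀ a ∈ A, ∀ s ∈ S, Commute a s)
    (hS : ∀ W : Submodule ℝ V, (∀ a ∈ A, ∀ w ∈ W, a w ∈ W) → (∀ s ∈ S, ∀ w ∈ W, s w ∈ W) →
      W = ⊥ ∨ W = ⊤)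
    (hA : ∀ x, (∀ a ∈ A, a x = 0) → x = 0) {f : Module.End ℝ V}
    (hf : ∀ c, (∀ a ∈ A, Commute a c) → Commute f c) : f ∈ A := by
  set R := Algebra.adjoin ℝ (A : Set (Module.End ℝ V)) with hR
  have hAR : ∀ a ∈ A, a ∈ R := fun a ha => Algebra.subset_adjoin ha
  have hRcomm : ∀ c, (∀ a ∈ A, Commute a c) → ∀ r ∈ R, Commute r c := by
    intro c hc r hr
    induction hr using Algebra.adjoin_induction with
    | mem x hx => exact hc x hx
    | algebraMap r => exact Algebra.commutes r c
    | add x y _ _ hx hy => exact hx.add_left hy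
    | mul x y _ _ hx hy => exact hx.mul_left hy
  -- `A` is a two-sided ideal of its unital hull `R`; the aim is `1 ∈ A`, whence `A = R`.
  have hideal : ∀ r ∈ R, ∀ a ∈ A, r * a ∈ A ∧ a * r ∈ A := by
    intro r hr
    induction hr using Algebra.adjoin_induction with
    | mem x hx => exact fun a ha => ⟨A.mul_mem hx ha, A.mul_mem ha hx⟩
    | algebraMap r =>
      intro a ha
      rw [Algebra.algebraMap_eq_smul_one, smul_one_mul, mul_smul_one]
      exact ⟨A.smul_mem' r ha, A.smul_mem' r ha⟩
    | add x y _ _ hx hy =>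
        intro a ha
        rw [add_mul, mul_add]
        exact ⟨A.add_mem (hx a ha).1 (hy a ha).1, A.add_mem (hx a ha).2 (hy a ha).2⟩
    | mul x y _ _ hx hy =>
        intro a ha
        rw [mul_assoc, ← mul_assoc a]
        exact ⟨(hx _ (hy a ha).1).1, (hy _ (hx a ha).2).2⟩
  have hss : IsSemisimpleModule R V := by
    refine isSemisimpleModule_of_stable {s | s.restrictScalars ℝ ∈ S} fun W hW => ?_
    have := hS (W.restrictScalars ℝ) (fun a ha w hw => W.smul_mem (⟨a, hAR a ha⟩ : R) hw)
      fun s hs w hw => hW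
        { toFun := s
          map_add' := map_add s
          map_smul' := fun a x =>
            (LinearMap.congr_fun (hRcomm s (fun a ha => hAS a ha s hs) a a.2).eq x).symm } hs w hw
    simpa using this
  let b := Module.finBasis ℝ V
  -- Evaluation on a basis embeds `R` in a finite power of `V`, so `R` is semisimple over itself and
  -- the ideal `A` has a complementary left ideal.
  let ev : R →ₗ[R] (Fin (Module.finrank ℝ V) → V) :=
    { toFun := fun r i => r • b i
      map_add' := fun r s => by ext i; simp [add_smul]
      map_smul' := fun r s => by ext i; simp [mul_smul] }
  have hev : Function.Injective ev := fun r s h =>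
    Subtype.ext (b.ext fun i => congrFun h i)
  have hssR : IsSemisimpleModule R R := IsSemisimpleModule.of_injective ev hev
  let I : Submodule R R :=
    { carrier := {r | (r : Module.End ℝ V) ∈ A}
      add_mem' := fun ha hb => A.add_mem ha hb
      zero_mem' := A.zero_mem
      smul_mem' := fun r a ha => (hideal r r.2 a ha).1 }
  obtain ⟨L, hL⟩ := exists_isCompl I
  obtain ⟨e, he, l, hl, hel⟩ := Submodule.mem_sup.mp (hL.sup_eq_top ▸ Submodule.mem_top :
    (1 : R) ∈ I ⊔ L)
  -- For `a ∈ A` the product `a * l` lies in both complements, so it vanishes; hence every `l x` is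
  -- killed by `A`.
  have hl0 : (l : Module.End ℝ V) = 0 := by
    ext x
    refine hA _ fun a ha => ?_
    have h1 : (⟨a, hAR a ha⟩ : R) * l ∈ I := (hideal l l.2 a ha).2
    have h2 : (⟨a, hAR a ha⟩ : R) * l ∈ L := L.smul_mem (⟨a, hAR a ha⟩ : R) hl
    have h3 := Submodule.disjoint_def.mp hL.disjoint _ h1 h2
    exact LinearMap.congr_fun (congrArg Subtype.val h3) x
  have h1 : (1 : Module.End ℝ V) ∈ A := by
    have := congrArg Subtype.val hel
    simp only [Subalgebra.coe_add, hl0, add_zero, Subalgebra.coe_one] at this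
    exact this ▸ he
  let f' : Module.End (Module.End R V) V :=
    { toFun := f
      map_add' := map_add f
      map_smul' := fun c x => by
        have := hf (c.restrictScalars ℝ) fun a ha => LinearMap.ext fun x =>
          (c.map_smul (⟨a, hAR a ha⟩ : R) x).symm
        exact LinearMap.congr_fun this.eq x }
  classical
  -- Density on a finite real basis already gives equality everywhere.
  obtain ⟨r, hr⟩ := jacobson_density (R := R) f' (Finset.univ.image b)
  have : f = r := b.ext fun i => hr _ (Finset.mem_image_of_mem _ (Finset.mem_univ i))
  rw [this, ← mul_one (r : Module.End ℝ V)]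
  exact (hideal r r.2 1 h1).1

end DoubleCentralizer

/-! ### Matrix algebras as algebras of real operators -/

section Matrices

open MulOpposite

variable {D : Type*} [DivisionRing D] [Algebra ℝ D] {n : ℕ}

/-- The real algebra homomorphism sending a matrix to its action on column vectors. -/
def mulVecEnd : Matrix (Fin n) (Fin n) D →ₐ[ℝ] Module.End ℝ (Fin n → D) :=
  AlgHom.ofLinearMap (Matrix.mulVecBilin ℝ ℝ) (LinearMap.ext fun x => by simp)
    (fun a b => LinearMap.ext fun x => by simp)

/-- The action of `D` on column vectors by right multiplication. -/
def rightMul : Dᵐᵒᵖ →ₐ[ℝ] Module.End ℝ (Fin n → D) := Algebra.lsmul ℝ ℝ (Fin n → D)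

@[simp]
theorem mulVecEnd_apply (a : Matrix (Fin n) (Fin n) D) (x : Fin n → D) :
    mulVecEnd a x = a *ᵥ x := rfl

@[simp]
theorem rightMul_apply (q : Dᵐᵒᵖ) (x : Fin n → D) : rightMul q x = q • x := rfl

theorem commute_mulVecEnd_rightMul (a : Matrix (Fin n) (Fin n) D) (q : Dᵐᵒᵖ) :
    Commute (mulVecEnd a) (rightMul q) :=
  LinearMap.ext fun x => Matrix.mulVec_smul a q x

theorem mulVecEnd_injective :
    Function.Injective (mulVecEnd : Matrix (Fin n) (Fin n) D → Module.End ℝ (Fin n → D)) := by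
  intro a b h
  ext i j
  simpa using congrFun (LinearMap.congr_fun h (Pi.single j 1)) i

/-- Two real-linear maps compatible with right multiplications up to an additive self-map of `D`
agree if they agree on the standard basis. -/
theorem end_ext {f g : Module.End ℝ (Fin n → D)} (σ : D → D)
    (hf : ∀ q x, f (op q • x) = op (σ q) • f x) (hg : ∀ q x, g (op q • x) = op (σ q) • g x)
    (h : ∀ k, f (Pi.single k 1) = g (Pi.single k 1)) : f = g := by
  refine LinearMap.pi_ext fun k q => ?_
  have : (Pi.single k q : Fin n → D) = op q • Pi.single k 1 := by
    ext i
    by_cases hik : i = k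
    · subst hik; simp
    · simp [hik]
  rw [this, hf, hg, h]

theorem exists_mulVecEnd_eq {f : Module.End ℝ (Fin n → D)}
    (hf : ∀ (q : Dᵐᵒᵖ) x, f (q • x) = q • f x) : ∃ a, mulVecEnd a = f := by
  refine ⟨Matrix.of fun i j => f (Pi.single j 1) i, end_ext id (fun q x => ?_) (fun q x => hf _ x)
    fun k => ?_⟩
  · exact LinearMap.congr_fun (commute_mulVecEnd_rightMul _ (op q)).eq x
  · ext i; simp

/-- `A` is closed under products, so the generated semigroup is `A` itself; a nonzero vector of `W`
has its spanning orbit inside `W`. -/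
theorem IsIrreducibleFamily.eq_bot_or_eq_top {A : NonUnitalSubalgebra ℝ (Matrix (Fin n) (Fin n) D)}
    (hA : IsIrreducibleFamily (A : Set (Matrix (Fin n) (Fin n) D)))
    {W : Submodule ℝ (Fin n → D)} (hW : ∀ a ∈ A, ∀ x ∈ W, a *ᵥ x ∈ W)
    (hWD : ∀ q : Dᵐᵒᵖ, ∀ x ∈ W, q • x ∈ W) : W = ⊥ ∨ W = ⊤ := by
  refine or_iff_not_imp_left.mpr fun hbot => ?_
  obtain ⟨x, hx, hx0⟩ := (Submodule.ne_bot_iff W).mp hbot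
  let W' : Submodule Dᵐᵒᵖ (Fin n → D) :=
    { W.toAddSubmonoid with smul_mem' := hWD }
  have hcl : Subsemigroup.closure (A : Set (Matrix (Fin n) (Fin n) D)) ≤
      A.toNonUnitalSubsemiring.toSubsemigroup := Subsemigroup.closure_le.mpr le_rfl
  have h : Submodule.span Dᵐᵒᵖ ((fun a : Matrix (Fin n) (Fin n) D => a *ᵥ x) ''
      (Subsemigroup.closure (A : Set (Matrix (Fin n) (Fin n) D)))) ≤ W' := Submodule.span_le.mpr (by
    rintro _ ⟨a, ha, rfl⟩
    exact hW a (hcl ha) x hx)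
  rw [hA x hx0] at h
  exact eq_top_iff.mpr fun y _ => h (Submodule.mem_top (x := y))

theorem IsIrreducibleFamily.eq_zero_of_forall_mulVec (hn : 0 < n)
    {A : NonUnitalSubalgebra ℝ (Matrix (Fin n) (Fin n) D)}
    (hA : IsIrreducibleFamily (A : Set (Matrix (Fin n) (Fin n) D)))
    {x : Fin n → D} (hx : ∀ a ∈ A, a *ᵥ x = 0) : x = 0 := by
  by_contra hx0
  have hcl : Subsemigroup.closure (A : Set (Matrix (Fin n) (Fin n) D)) ≤
      A.toNonUnitalSubsemiring.toSubsemigroup := Subsemigroup.closure_le.mpr le_rfl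
  have h : Submodule.span Dᵐᵒᵖ ((fun a : Matrix (Fin n) (Fin n) D => a *ᵥ x) ''
      (Subsemigroup.closure (A : Set (Matrix (Fin n) (Fin n) D)))) ≤ ⊥ := Submodule.span_le.mpr (by
    rintro _ ⟨a, ha, rfl⟩
    exact hx a (hcl ha))
  rw [hA x hx0] at h
  have : Nonempty (Fin n) := ⟨⟨0, hn⟩⟩
  exact absurd (top_le_iff.mp h.ge.le) (by simp)

/-- The double centralizer theorem with `S` the right multiplications. The commutant is taken among
all real endomorphisms, not only right-linear ones. -/
theorem IsIrreducibleFamily.mem_of_commute_centralizer [Module.Finite ℝ D] (hn : 0 < n)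
    {A : NonUnitalSubalgebra ℝ (Matrix (Fin n) (Fin n) D)}
    (hA : IsIrreducibleFamily (A : Set (Matrix (Fin n) (Fin n) D)))
    {b : Matrix (Fin n) (Fin n) D}
    (hb : ∀ c ∈ Subalgebra.centralizer ℝ (mulVecEnd '' (A : Set (Matrix (Fin n) (Fin n) D))),
      Commute (mulVecEnd b) c) : b ∈ A := by
  have : mulVecEnd b ∈ A.map (mulVecEnd : Matrix (Fin n) (Fin n) D →ₐ[ℝ] _) := by
    refine BurnsideType.mem_of_commute_centralizer _
      (Set.range (rightMul : Dᵐᵒᵖ → Module.End ℝ (Fin n → D))) ?_ ?_ ?_ ?_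
    · rintro _ ⟨a, ha, rfl⟩ _ ⟨q, rfl⟩
      exact commute_mulVecEnd_rightMul a q
    · intro W hW hWD
      exact hA.eq_bot_or_eq_top (fun a ha x hx => hW _ ⟨a, ha, rfl⟩ x hx)
        (fun q x hx => hWD _ ⟨q, rfl⟩ x hx)
    · intro x hx
      exact hA.eq_zero_of_forall_mulVec hn fun a ha => hx _ ⟨a, ha, rfl⟩
    · intro c hc
      refine hb c ?_
      rw [Subalgebra.mem_centralizer_iff]
      rintro _ ⟨a, ha, rfl⟩
      exact (hc _ ⟨a, ha, rfl⟩).eq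
  obtain ⟨a, ha, hab⟩ := this
  exact mulVecEnd_injective hab ▸ ha

theorem commute_of_mem_centralizer {A : NonUnitalSubalgebra ℝ (Matrix (Fin n) (Fin n) D)}
    {b : Matrix (Fin n) (Fin n) D} (hb : b ∈ A) {c : Module.End ℝ (Fin n → D)}
    (hc : c ∈ Subalgebra.centralizer ℝ (mulVecEnd '' (A : Set (Matrix (Fin n) (Fin n) D)))) :
    Commute (mulVecEnd b) c :=
  (Subalgebra.mem_centralizer_iff ℝ).mp hc _ ⟨b, hb, rfl⟩

/-- A Schur-type lemma. -/
theorem IsIrreducibleFamily.eq_zero_of_apply_eq_zero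
    {A : NonUnitalSubalgebra ℝ (Matrix (Fin n) (Fin n) D)}
    (hA : IsIrreducibleFamily (A : Set (Matrix (Fin n) (Fin n) D)))
    {c : Module.End ℝ (Fin n → D)}
    (hc : c ∈ Subalgebra.centralizer ℝ (mulVecEnd '' (A : Set (Matrix (Fin n) (Fin n) D))))
    (hcD : ∀ (q : Dᵐᵒᵖ) x, c x = 0 → c (q • x) = 0) {x : Fin n → D} (hx : c x = 0) (hx0 : x ≠ 0) :
    c = 0 := by
  -- Only the kernel of `c` must be a right subspace, so conjugate-linear `c` are covered too.
  have hker : ∀ a ∈ A, ∀ y ∈ LinearMap.ker c, a *ᵥ y ∈ LinearMap.ker c := fun a ha y hy => by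
    have := LinearMap.congr_fun (commute_of_mem_centralizer ha hc).eq y
    simp only [Module.End.mul_apply, mulVecEnd_apply, LinearMap.mem_ker.mp hy,
      Matrix.mulVec_zero] at this
    exact this.symm
  rcases hA.eq_bot_or_eq_top hker (fun q y hy => hcD q y hy) with h | h
  · exact absurd ((Submodule.mem_bot ℝ).mp (h ▸ LinearMap.mem_ker.mpr hx)) hx0
  · exact LinearMap.ker_eq_top.mp h

/-- The commutants of two pairs of operators that are intertwined by a right-linear automorphism
are similar. -/
theorem isSimilar_of_intertwining {A B : Set (Matrix (Fin n) (Fin n) D)}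
    {J K J₀ K₀ : Module.End ℝ (Fin n → D)} (e : (Fin n → D) ≃ₗ[ℝ] (Fin n → D))
    (he : ∀ (q : Dᵐᵒᵖ) x, e (q • x) = q • e x)
    (hJ : ∀ x, e (J x) = J₀ (e x)) (hK : ∀ x, e (K x) = K₀ (e x))
    (hA : ∀ b, b ∈ A ↔ Commute (mulVecEnd b) J ∧ Commute (mulVecEnd b) K)
    (hB : ∀ b, b ∈ B ↔ Commute (mulVecEnd b) J₀ ∧ Commute (mulVecEnd b) K₀) :
    IsSimilar A B := by
  -- Right-linearity makes `e` a matrix, and conjugation by it matches the two commutants. A single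
  -- generator is the case `K = J`.
  obtain ⟨P, hP⟩ := exists_mulVecEnd_eq (f := e.toLinearMap) he
  obtain ⟨Q, hQ⟩ := exists_mulVecEnd_eq (f := e.symm.toLinearMap) fun q x => by
    apply e.injective
    simp [he]
  have hPQ : P * Q = 1 := mulVecEnd_injective (by rw [map_mul, hP, hQ, map_one]; ext; simp)
  have hQP : Q * P = 1 := mulVecEnd_injective (by rw [map_mul, hP, hQ, map_one]; ext; simp)
  have intertwine : ∀ {J J₀ : Module.End ℝ (Fin n → D)}, (∀ x, e (J x) = J₀ (e x)) →
      ∀ b, Commute (mulVecEnd (Q * b * P)) J ↔ Commute (mulVecEnd b) J₀ := by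
    intro J J₀ hJ b
    have h1 : mulVecEnd P * J = J₀ * mulVecEnd P := by rw [hP]; exact LinearMap.ext hJ
    have hPQ' : mulVecEnd P * mulVecEnd Q = 1 := by rw [← map_mul, hPQ, map_one]
    have hQP' : mulVecEnd Q * mulVecEnd P = 1 := by rw [← map_mul, hQP, map_one]
    have h2 : J * mulVecEnd Q = mulVecEnd Q * J₀ := by
      calc J * mulVecEnd Q = mulVecEnd Q * (mulVecEnd P * J) * mulVecEnd Q := by
            rw [← mul_assoc, hQP', one_mul]
        _ = _ := by rw [h1, mul_assoc, mul_assoc, hPQ', mul_one]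
    have h3 : mulVecEnd (Q * b * P) * J = mulVecEnd Q * (mulVecEnd b * J₀) * mulVecEnd P := by
      simp only [map_mul, mul_assoc, h1]
    have h4 : J * mulVecEnd (Q * b * P) = mulVecEnd Q * (J₀ * mulVecEnd b) * mulVecEnd P := by
      simp only [map_mul, ← mul_assoc, h2]
    rw [commute_iff_eq, commute_iff_eq, h3, h4]
    refine ⟨fun h => ?_, fun h => by rw [h]⟩
    have := congrArg (fun z => mulVecEnd P * z * mulVecEnd Q) h
    simpa only [mul_assoc, hPQ', mul_one, ← mul_assoc (mulVecEnd P) (mulVecEnd Q), one_mul]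
      using this
  refine ⟨⟨P, Q, hPQ, hQP⟩, Set.ext fun a => ⟨fun ha => ⟨P * a * Q, ?_, ?_⟩, ?_⟩⟩
  · have h : Q * (P * a * Q) * P = a := by
      simp only [mul_assoc, hQP, mul_one]
      rw [← mul_assoc, hQP, one_mul]
    rw [hB, ← intertwine hJ, ← intertwine hK, h]
    exact (hA a).mp ha
  · change Q * (P * a * Q) * P = a
    simp only [mul_assoc, hQP, mul_one]
    rw [← mul_assoc, hQP, one_mul]
  · rintro ⟨b, hb, rfl⟩
    change Q * b * P ∈ A
    rw [hA, intertwine hJ, intertwine hK]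
    exact (hB b).mp hb

end Matrices

/-! ### Representations of real division algebras -/

section Intertwining

variable {E V W : Type*} [DivisionRing E] [Algebra ℝ E]
  [AddCommGroup V] [Module ℝ V]
  [AddCommGroup W] [Module ℝ W]

/-- `V` becomes an `E`-vector space and dimensions multiply. This is the source of the divisibility
of `n`. -/
theorem finrank_dvd_of_algHom (φ : E →ₐ[ℝ] Module.End ℝ V) :
    Module.finrank ℝ E ∣ Module.finrank ℝ V := by
  let _ : Module E V := Module.compHom V φ.toRingHom
  have : IsScalarTower ℝ E V := ⟨fun r q x => by
    change φ (r • q) x = r • φ q x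
    rw [map_smul]; rfl⟩
  exact ⟨_, (Module.finrank_mul_finrank ℝ E V).symm⟩

/-- Two representations of a finite-dimensional real division algebra on spaces of the same
dimension are isomorphic. -/
theorem exists_intertwining [Module.Finite ℝ E] [Module.Finite ℝ V] [Module.Finite ℝ W]
    (φ : E →ₐ[ℝ] Module.End ℝ V) (ψ : E →ₐ[ℝ] Module.End ℝ W)
    (h : Module.finrank ℝ V = Module.finrank ℝ W) :
    ∃ e : V ≃ₗ[ℝ] W, ∀ q x, e (φ q x) = ψ q (e x) := by
  let _ : Module E V := Module.compHom V φ.toRingHom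
  let _ : Module E W := Module.compHom W ψ.toRingHom
  have : IsScalarTower ℝ E V := ⟨fun r q x => by
    change φ (r • q) x = r • φ q x
    rw [map_smul]; rfl⟩
  have : IsScalarTower ℝ E W := ⟨fun r q x => by
    change ψ (r • q) x = r • ψ q x
    rw [map_smul]; rfl⟩
  have : Module.Finite E V := Module.Finite.of_restrictScalars_finite ℝ E V
  have : Module.Finite E W := Module.Finite.of_restrictScalars_finite ℝ E W
  have hE : 0 < Module.finrank ℝ E := Module.finrank_pos
  have : Module.finrank E V = Module.finrank E W := by
    rw [← Module.finrank_mul_finrank ℝ E V, ← Module.finrank_mul_finrank ℝ E W] at h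
    exact Nat.eq_of_mul_eq_mul_left hE h
  let e : V ≃ₗ[E] W := LinearEquiv.ofFinrankEq V W this
  exact ⟨e.restrictScalars ℝ, fun q x => e.map_smul q x⟩

end Intertwining

/-! ### Rank bounds -/

section Rank

variable {D : Type*} [DivisionRing D] {n : ℕ}

theorem rightRank_eq_finrank_range (a : Matrix (Fin n) (Fin n) D) :
    rightRank a = Module.finrank Dᵐᵒᵖ (LinearMap.range (Matrix.mulVecBilin D Dᵐᵒᵖ a)) := by
  rw [rightRank, ← Submodule.span_eq (LinearMap.range (Matrix.mulVecBilin D Dᵐᵒᵖ a))]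
  rfl

instance : Module.Finite Dᵐᵒᵖ D :=
  Module.Finite.of_surjective (LinearMap.toSpanSingleton Dᵐᵒᵖ D 1) fun q =>
    ⟨MulOpposite.op q, by simp⟩

theorem rightRank_mul_le_left (a b : Matrix (Fin n) (Fin n) D) :
    rightRank (a * b) ≤ rightRank a := by
  rw [rightRank_eq_finrank_range, rightRank_eq_finrank_range]
  refine Submodule.finrank_mono ?_
  rintro _ ⟨x, rfl⟩
  exact ⟨b *ᵥ x, by simp⟩

theorem rightRank_mul_le_right (a b : Matrix (Fin n) (Fin n) D) :
    rightRank (a * b) ≤ rightRank b := by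
  rw [rightRank_eq_finrank_range, rightRank_eq_finrank_range]
  have : Matrix.mulVecBilin D Dᵐᵒᵖ (a * b) =
      Matrix.mulVecBilin D Dᵐᵒᵖ a ∘ₗ Matrix.mulVecBilin D Dᵐᵒᵖ b := LinearMap.ext fun x => by simp
  rw [this, LinearMap.range_comp]
  exact Submodule.finrank_map_le _ _

theorem rightRank_le_card {b : Matrix (Fin n) (Fin n) D} (T : Finset (Fin n))
    (hb : ∀ i ∉ T, ∀ j, b i j = 0) : rightRank b ≤ T.card := by
  classical
  have hle : Submodule.span Dᵐᵒᵖ (Set.range fun x : Fin n → D => b *ᵥ x) ≤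
      Submodule.span Dᵐᵒᵖ (T.image fun i => (Pi.single i 1 : Fin n → D) : Finset (Fin n → D)) := by
    refine Submodule.span_le.mpr ?_
    rintro _ ⟨x, rfl⟩
    have : b *ᵥ x = ∑ i ∈ T, MulOpposite.op ((b *ᵥ x) i) • (Pi.single i 1 : Fin n → D) := by
      ext k
      by_cases hk : k ∈ T
      · simp [Finset.sum_apply, Pi.single_apply, hk]
      · have h0 : (b *ᵥ x) k = 0 := by
          simp [Matrix.mulVec, dotProduct, hb k hk]
        simp [Finset.sum_apply, Pi.single_apply, hk, h0]
    change b *ᵥ x ∈ _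
    rw [this]
    refine Submodule.sum_mem _ fun i hi => Submodule.smul_mem _ _ (Submodule.subset_span ?_)
    exact Finset.mem_coe.mpr (Finset.mem_image_of_mem _ hi)
  calc rightRank b ≤ _ := Submodule.finrank_mono hle
    _ ≤ _ := finrank_span_finset_le_card _
    _ ≤ T.card := Finset.card_image_le

/-- A division algebra acting on column vectors and commuting with a nonzero matrix bounds the rank
of that matrix from below. -/
theorem finrank_le_mul_rightRank [Algebra ℝ D] [Module.Finite ℝ D] {E : Type*} [DivisionRing E]
    [Algebra ℝ E] (φ : E →ₐ[ℝ] Module.End ℝ (Fin n → D)) {a : Matrix (Fin n) (Fin n) D}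
    (ha : a ≠ 0) (hφ : ∀ q, Commute (mulVecEnd a) (φ q)) :
    Module.finrank ℝ E ≤ Module.finrank ℝ D * rightRank a := by
  have : ∃ x, a *ᵥ x ≠ 0 := by
    by_contra h
    push Not at h
    exact ha (mulVecEnd_injective (LinearMap.ext fun x => by simpa using h x))
  obtain ⟨x, hx⟩ := this
  set R := LinearMap.range (Matrix.mulVecBilin D Dᵐᵒᵖ a) with hR
  -- Since `a φ(q) x = φ(q) (a x)` and `φ(q)` is invertible for `q ≠ 0`, this map embeds `E` in the
  -- image of `a`.
  let g : E →ₗ[ℝ] R :=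
    { toFun := fun q => ⟨a *ᵥ (φ q x), ⟨φ q x, rfl⟩⟩
      map_add' := fun p q => by ext; simp [Matrix.mulVec_add]
      map_smul' := fun r q => by ext; simp [Matrix.mulVec_smul] }
  have hg : Function.Injective g := by
    refine (injective_iff_map_eq_zero g).mpr fun q hq => ?_
    by_contra hq0
    have h1 : a *ᵥ (φ q x) = 0 := congrArg Subtype.val hq
    have h2 : φ q (a *ᵥ x) = 0 := by
      rw [← h1]; exact (LinearMap.congr_fun (hφ q).eq x).symm
    apply hx
    have h3 : φ (q⁻¹ * q) (a *ᵥ x) = 0 := by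
      rw [map_mul, Module.End.mul_apply, h2, map_zero]
    rwa [inv_mul_cancel₀ hq0, map_one, Module.End.one_apply] at h3
  have : Module.Finite ℝ Dᵐᵒᵖ := Module.Finite.equiv (MulOpposite.opLinearEquiv ℝ)
  have : Module.Finite ℝ R := Module.Finite.trans Dᵐᵒᵖ R
  calc Module.finrank ℝ E ≤ Module.finrank ℝ R := LinearMap.finrank_le_finrank_of_injective hg
    _ = Module.finrank ℝ Dᵐᵒᵖ * Module.finrank Dᵐᵒᵖ R :=
      (Module.finrank_mul_finrank ℝ Dᵐᵒᵖ R).symm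
    _ = _ := by
      rw [rightRank_eq_finrank_range, (MulOpposite.opLinearEquiv ℝ (M := D)).finrank_eq]

/-- The lower bound applied to `ℝ` acting by scalars. -/
theorem rightRank_ne_zero [Algebra ℝ D] [Module.Finite ℝ D] {a : Matrix (Fin n) (Fin n) D}
    (ha : a ≠ 0) : rightRank a ≠ 0 := by
  intro h
  have := finrank_le_mul_rightRank (Algebra.ofId ℝ (Module.End ℝ (Fin n → D))) ha
    fun q => (Algebra.commutes q _).symm
  simp [h] at this

/-- The minimal nonzero rank in a set of matrices similar to one containing a matrix of small
rank. -/
theorem isLeast_nonzeroRanks [Algebra ℝ D] [Module.Finite ℝ D]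
    {A B : Set (Matrix (Fin n) (Fin n) D)}
    (hAB : IsSimilar A B) {d : ℕ} (hA : ∀ a ∈ A, a ≠ 0 → d ≤ rightRank a)
    {b : Matrix (Fin n) (Fin n) D} (hb : b ∈ B) (hb0 : b ≠ 0) (hbd : rightRank b ≤ d) :
    IsLeast (nonzeroRanks A) d := by
  obtain ⟨⟨P, Q, hPQ, hQP⟩, hP⟩ := hAB
  change A = (fun B => Q * B * P) '' B at hP
  have ha : Q * b * P ∈ A := by rw [hP]; exact ⟨b, hb, rfl⟩
  have ha0 : Q * b * P ≠ 0 := by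
    intro h
    apply hb0
    calc b = P * (Q * b * P) * Q := by
          simp only [mul_assoc, hPQ, mul_one]; rw [← mul_assoc, hPQ, one_mul]
      _ = 0 := by rw [h, mul_zero, zero_mul]
  have hle : rightRank (Q * b * P) = d :=
    le_antisymm (((rightRank_mul_le_left _ _).trans (rightRank_mul_le_right _ _)).trans hbd)
      (hA _ ha ha0)
  refine ⟨⟨hle ▸ rightRank_ne_zero ha0, _, ha, hle⟩, ?_⟩
  rintro k ⟨hk, a, haA, rfl⟩
  refine hA a haA ?_
  rintro rfl
  apply hk
  have := rightRank_le_card (b := (0 : Matrix (Fin n) (Fin n) D)) ∅ (by simp)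
  simpa using this

end Rank

/-! ### Block matrices -/

section Blocks

variable {D E : Type*} {m d n : ℕ}

/-- Matrices of blocks are the same as matrices of larger size. -/
def blockRingEquiv [Ring D] (h : n = m * d) :
    Matrix (Fin m) (Fin m) (Matrix (Fin d) (Fin d) D) ≃+* Matrix (Fin n) (Fin n) D :=
  (Matrix.compRingEquiv (Fin m) (Fin d) D).trans
    (Matrix.reindexRingEquiv D (finProdFinEquiv.trans (finCongr h.symm)))

theorem blockMatrix_eq [Ring D] (h : n = m * d) (f : E → Matrix (Fin d) (Fin d) D)
    (Z : Matrix (Fin m) (Fin m) E) : blockMatrix h f Z = blockRingEquiv h (Z.map f) := rfl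

theorem scalar_commute_iff_forall {α ι : Type*} [Ring α] [Fintype ι] [DecidableEq ι] {q : α}
    {b : Matrix ι ι α} : Commute b (Matrix.scalar ι q) ↔ ∀ i j, Commute (b i j) q := by
  rw [Commute.symm_iff, Matrix.scalar_commute_iff, ← Matrix.ext_iff]
  simp [commute_iff_eq, eq_comm]

theorem mem_range_blockMatrix_iff [Ring D] (h : n = m * d) {f : E → Matrix (Fin d) (Fin d) D}
    (b : Matrix (Fin n) (Fin n) D) : b ∈ Set.range (blockMatrix h f) ↔
      ∀ k l, (blockRingEquiv h).symm b k l ∈ Set.range f := by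
  constructor
  · rintro ⟨Z, rfl⟩ k l
    rw [blockMatrix_eq, RingEquiv.symm_apply_apply]
    exact ⟨Z k l, rfl⟩
  · intro hb
    choose Z hZ using hb
    refine ⟨Matrix.of Z, ?_⟩
    rw [blockMatrix_eq, ← RingEquiv.eq_symm_apply]
    exact Matrix.ext fun k l => hZ k l

/-- Reduces commuting with a block-scalar operator to a condition on each block. -/
theorem commute_blockRingEquiv_scalar_iff [Ring D] (h : n = m * d) (R : Matrix (Fin d) (Fin d) D)
    (b : Matrix (Fin n) (Fin n) D) : Commute b (blockRingEquiv h (Matrix.scalar (Fin m) R)) ↔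
      ∀ k l, Commute ((blockRingEquiv h).symm b k l) R := by
  rw [← scalar_commute_iff_forall, commute_iff_eq, commute_iff_eq,
    ← (blockRingEquiv h).injective.eq_iff]
  simp only [map_mul, RingEquiv.apply_symm_apply]

/-- All rows outside the `k`-th block vanish, leaving at most `d` nonzero rows. -/
theorem rightRank_blockMatrix_single_le [DivisionRing D] [Zero E] [One E] (h : n = m * d)
    (k : Fin m) {f : E → Matrix (Fin d) (Fin d) D} (h0 : f 0 = 0) :
    rightRank (blockMatrix h f (Matrix.single k k 1)) ≤ d := by
  set idx : Fin m × Fin d ≃ Fin n := finProdFinEquiv.trans (finCongr h.symm)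
  refine (rightRank_le_card (Finset.univ.image fun s : Fin d => idx (k, s)) ?_).trans
    (Finset.card_image_le.trans (by simp))
  intro i hi j
  have hik : k ≠ (idx.symm i).1 := by
    rintro rfl
    exact hi (Finset.mem_image.mpr ⟨(idx.symm i).2, Finset.mem_univ _, by simp⟩)
  change f (Matrix.single k k 1 (idx.symm i).1 (idx.symm j).1) _ _ = 0
  rw [Matrix.single_apply_of_row_ne hik, h0, Matrix.zero_apply]

theorem blockMatrix_single_ne_zero [Ring D] [Zero E] [One E] (h : n = m * d)
    (k : Fin m) {f : E → Matrix (Fin d) (Fin d) D} (h1 : f 1 ≠ 0) :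
    blockMatrix h f (Matrix.single k k 1) ≠ 0 := by
  intro hz
  rw [blockMatrix_eq, ← map_zero (blockRingEquiv h), (blockRingEquiv h).injective.eq_iff] at hz
  have := congrFun (congrFun hz k) k
  simp [h1] at this

theorem isLeast_nonzeroRanks_of_block [DivisionRing D] [Algebra ℝ D] [Module.Finite ℝ D]
    [Zero E] [One E] (hn : 0 < n) (h : n = m * d) {f : E → Matrix (Fin d) (Fin d) D} (h0 : f 0 = 0)
    (h1 : f 1 ≠ 0) {A : Set (Matrix (Fin n) (Fin n) D)}
    (hAB : IsSimilar A (Set.range (blockMatrix h f))) (hA : ∀ a ∈ A, a ≠ 0 → d ≤ rightRank a) :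
    IsLeast (nonzeroRanks A) d := by
  have hm : 0 < m := Nat.pos_of_ne_zero fun hm => by simp [hm] at h; omega
  exact isLeast_nonzeroRanks hAB hA ⟨_, rfl⟩ (blockMatrix_single_ne_zero h ⟨0, hm⟩ h1)
    (rightRank_blockMatrix_single_le h ⟨0, hm⟩ h0)

theorem isLeast_nonzeroRanks_one [DivisionRing D] [Algebra ℝ D] [Module.Finite ℝ D]
    {A B : Set (Matrix (Fin n) (Fin n) D)} (hAB : IsSimilar A B) (i : Fin n)
    (hB : Matrix.single i i 1 ∈ B) : IsLeast (nonzeroRanks A) 1 := by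
  refine isLeast_nonzeroRanks hAB
    (fun a _ ha => Nat.one_le_iff_ne_zero.mpr (rightRank_ne_zero ha)) hB ?_ ?_
  · intro h
    simpa using congrFun (congrFun h i) i
  · have h : ∀ k ∉ ({i} : Finset (Fin n)), ∀ j, Matrix.single i i (1 : D) k j = 0 := by
      intro k hk j
      have hik : i ≠ k := by simpa [eq_comm] using hk
      simp [hik]
    simpa using rightRank_le_card _ h

theorem isSimilar_refl [Ring D] (A : Set (Matrix (Fin n) (Fin n) D)) : IsSimilar A A :=
  ⟨1, by simp⟩

end Blocks

/-! ### Actions of `ℍ` and `ℂ` from generators -/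

section QuaternionAction

variable {E : Type*} [Ring E] [Algebra ℝ E]

/-- The algebra homomorphism from the quaternions determined by two anticommuting square roots
of `-1`. -/
def quaternionLift (J K : E) (hJ : J * J = -1) (hK : K * K = -1) (hKJ : K * J = -(J * K)) :
    ℍ[ℝ] →ₐ[ℝ] E :=
  QuaternionAlgebra.lift ⟨J, K, J * K, by simp [hJ], by simp [hK], rfl, by simp [hKJ]⟩

variable {J K : E} (hJ : J * J = -1) (hK : K * K = -1) (hKJ : K * J = -(J * K))

theorem quaternionLift_apply (q : ℍ[ℝ]) : quaternionLift J K hJ hK hKJ q =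
    algebraMap ℝ E q.re + q.imI • J + q.imJ • K + q.imK • (J * K) := rfl

theorem quaternionLift_I : quaternionLift J K hJ hK hKJ ⟨0, 1, 0, 0⟩ = J := by
  change algebraMap ℝ E 0 + (1 : ℝ) • J + (0 : ℝ) • K + (0 : ℝ) • (J * K) = J
  simp

theorem quaternionLift_J : quaternionLift J K hJ hK hKJ ⟨0, 0, 1, 0⟩ = K := by
  change algebraMap ℝ E 0 + (0 : ℝ) • J + (1 : ℝ) • K + (0 : ℝ) • (J * K) = K
  simp

theorem commute_quaternionLift {f : E} (hfJ : Commute f J) (hfK : Commute f K) (q : ℍ[ℝ]) :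
    Commute f (quaternionLift J K hJ hK hKJ q) := by
  rw [quaternionLift_apply]
  exact (((Algebra.commute_algebraMap_right _ f).add_right (hfJ.smul_right _)).add_right
    (hfK.smul_right _)).add_right ((hfJ.mul_right hfK).smul_right _)

theorem commute_complexLift {f : E} (hfJ : Commute f J) (q : ℂ) :
    Commute f (Complex.lift ⟨J, hJ⟩ q) := by
  rw [Complex.lift_apply, Complex.liftAux_apply]
  exact (Algebra.commute_algebraMap_right q.re f).add_right (hfJ.smul_right q.im)

end QuaternionAction

/-! ### Bases of the right vector space -/

section Basis

open MulOpposite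

variable {D : Type*} [DivisionRing D] {n : ℕ}

/-- The standard basis of the right vector space of column vectors. -/
noncomputable def rightBasis : Module.Basis (Fin n) Dᵐᵒᵖ (Fin n → D) :=
  Module.Basis.ofEquivFun
    { toFun := fun x i => op (x i)
      invFun := fun x i => unop (x i)
      map_add' := fun _ _ => rfl
      map_smul' := fun _ _ => rfl }

theorem rightBasis_apply (k : Fin n) : (rightBasis k : Fin n → D) = Pi.single k 1 := by
  ext i
  have h : (rightBasis k : Fin n → D) i = unop ((Pi.single k 1 : Fin n → Dᵐᵒᵖ) i) := by
    simp only [rightBasis, Module.Basis.coe_ofEquivFun]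
    rfl
  rw [h]
  by_cases hik : i = k
  · subst hik; simp
  · simp [hik]

/-- A spanning set of column vectors contains the preimage of the standard basis under some
right-linear automorphism. -/
theorem exists_linearEquiv_of_span_eq_top {W : Set (Fin n → D)}
    (hW : Submodule.span Dᵐᵒᵖ W = ⊤) :
    ∃ e : (Fin n → D) ≃ₗ[Dᵐᵒᵖ] (Fin n → D), ∀ k, e.symm (Pi.single k 1) ∈ W := by
  let b := Module.Basis.ofSpan hW.ge
  have hb : Set.range b ⊆ W := Module.Basis.ofSpan_subset hW.ge
  let σ := b.indexEquiv (rightBasis (D := D) (n := n))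
  refine ⟨b.equiv rightBasis σ, fun k => ?_⟩
  rw [← rightBasis_apply, Module.Basis.equiv_symm, Module.Basis.equiv_apply]
  exact hb ⟨_, rfl⟩

end Basis

/-! ### Commutants of an irreducible algebra -/

section Centralizer

variable {D : Type*} [DivisionRing D] [Algebra ℝ D] {n : ℕ}

/-- The centralizer of a set of matrices in the algebra of real-linear endomorphisms. -/
def realCentralizer (A : Set (Matrix (Fin n) (Fin n) D)) :
    Subalgebra ℝ (Module.End ℝ (Fin n → D)) :=
  Subalgebra.centralizer ℝ (mulVecEnd '' A)

/-- The centralizer of a set of matrices in the algebra of right-linear endomorphisms. -/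
def rightCentralizer (A : Set (Matrix (Fin n) (Fin n) D)) :
    Subalgebra ℝ (Module.End ℝ (Fin n → D)) :=
  realCentralizer A ⊓ Subalgebra.centralizer ℝ (Set.range rightMul)

theorem mem_rightCentralizer_iff {A : Set (Matrix (Fin n) (Fin n) D)}
    {c : Module.End ℝ (Fin n → D)} :
    c ∈ rightCentralizer A ↔ c ∈ realCentralizer A ∧ ∀ q, Commute c (rightMul q) := by
  rw [rightCentralizer, Algebra.mem_inf, Subalgebra.mem_centralizer_iff (R := ℝ)]
  simp [commute_iff_eq, eq_comm]

theorem rightMul_mem_realCentralizer (A : Set (Matrix (Fin n) (Fin n) D)) (q : Dᵐᵒᵖ) :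
    rightMul q ∈ realCentralizer A := by
  rw [realCentralizer, Subalgebra.mem_centralizer_iff]
  rintro _ ⟨a, -, rfl⟩
  exact (commute_mulVecEnd_rightMul a q).eq

variable {A : NonUnitalSubalgebra ℝ (Matrix (Fin n) (Fin n) D)}

/-- Hypothesis `h` says that, as far as commuting with matrices goes, `J` and `K` generate the
commutant; the double centralizer property then recovers `A` from them. -/
theorem mem_iff_of_generators [Module.Finite ℝ D]
    (hA : IsIrreducibleFamily (A : Set (Matrix (Fin n) (Fin n) D))) (hn : 0 < n)
    {J K : Module.End ℝ (Fin n → D)}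
    (hJ : J ∈ realCentralizer (A : Set (Matrix (Fin n) (Fin n) D)))
    (hK : K ∈ realCentralizer (A : Set (Matrix (Fin n) (Fin n) D)))
    (h : ∀ b, Commute (mulVecEnd b) J → Commute (mulVecEnd b) K →
      ∀ c ∈ realCentralizer (A : Set (Matrix (Fin n) (Fin n) D)), Commute (mulVecEnd b) c)
    (b : Matrix (Fin n) (Fin n) D) :
    b ∈ (A : Set (Matrix (Fin n) (Fin n) D)) ↔
      Commute (mulVecEnd b) J ∧ Commute (mulVecEnd b) K :=
  ⟨fun hb => ⟨commute_of_mem_centralizer hb hJ, commute_of_mem_centralizer hb hK⟩,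
    fun hb => hA.mem_of_commute_centralizer hn (h b hb.1 hb.2)⟩

/-- If `y v ≠ 0`, then `x` kills a nonzero vector and Schur's lemma applies. -/
theorem eq_zero_or_eq_zero_of_mul_eq_zero
    (hA : IsIrreducibleFamily (A : Set (Matrix (Fin n) (Fin n) D)))
    {x y : Module.End ℝ (Fin n → D)}
    (hx : x ∈ realCentralizer (A : Set (Matrix (Fin n) (Fin n) D)))
    (hxD : ∀ (q : Dᵐᵒᵖ) v, x v = 0 → x (q • v) = 0) (hxy : x * y = 0) : x = 0 ∨ y = 0 := by
  by_cases hy : y = 0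
  · exact Or.inr hy
  left
  have : ∃ v, y v ≠ 0 := by
    by_contra h
    push Not at h
    exact hy (LinearMap.ext h)
  obtain ⟨v, hv⟩ := this
  exact hA.eq_zero_of_apply_eq_zero hx hxD (LinearMap.congr_fun hxy v) hv

theorem rightCentralizer_mul_eq_zero
    (hA : IsIrreducibleFamily (A : Set (Matrix (Fin n) (Fin n) D)))
    {x y : Module.End ℝ (Fin n → D)}
    (hx : x ∈ rightCentralizer (A : Set (Matrix (Fin n) (Fin n) D))) (hxy : x * y = 0) :
    x = 0 ∨ y = 0 := by
  rw [mem_rightCentralizer_iff] at hx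
  refine eq_zero_or_eq_zero_of_mul_eq_zero hA hx.1 (fun q v hv => ?_) hxy
  have := LinearMap.congr_fun (hx.2 q).eq v
  simpa [hv] using this

end Centralizer

/-! ### Standard forms as commutants -/

section StandardForms

theorem commute_mulVecEnd_iff {D : Type*} [DivisionRing D] [Algebra ℝ D] {n : ℕ}
    {a b : Matrix (Fin n) (Fin n) D} :
    Commute (mulVecEnd a) (mulVecEnd b) ↔ Commute a b := by
  rw [commute_iff_eq, commute_iff_eq, ← map_mul, ← map_mul, mulVecEnd_injective.eq_iff]

theorem mem_range_complexToReal_iff (M : Matrix (Fin 2) (Fin 2) ℝ) :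
    M ∈ Set.range complexToReal ↔ Commute M !![0, -1; 1, 0] := by
  have key : Commute M !![0, -1; 1, 0] ↔ M 0 1 = -M 1 0 ∧ M 0 0 = M 1 1 := by
    rw [commute_iff_eq, ← Matrix.ext_iff]
    simp only [Fin.forall_fin_two, Matrix.mul_apply, Fin.sum_univ_two]
    simp
    grind
  rw [key]
  constructor
  · rintro ⟨z, rfl⟩
    simp [complexToReal]
  · rintro ⟨h1, h2⟩
    refine ⟨⟨M 0 0, M 1 0⟩, ?_⟩
    ext i j
    fin_cases i <;> fin_cases j <;> simp [complexToReal, h1, h2]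

/-- The two matrices are anticommuting square roots of `-1`; they generate a second copy of `ℍ`,
whose commutant is the standard one. -/
theorem mem_range_quaternionToReal_iff (M : Matrix (Fin 4) (Fin 4) ℝ) :
    M ∈ Set.range quaternionToReal ↔
      Commute M !![0, -1, 0, 0; 1, 0, 0, 0; 0, 0, 0, -1; 0, 0, 1, 0] ∧
      Commute M !![0, 0, -1, 0; 0, 0, 0, 1; 1, 0, 0, 0; 0, -1, 0, 0] := by
  have hI : Commute M !![0, -1, 0, 0; 1, 0, 0, 0; 0, 0, 0, -1; 0, 0, 1, 0] ↔
      (M 0 1 = -M 1 0 ∧ M 0 0 = M 1 1 ∧ M 0 3 = -M 1 2 ∧ M 0 2 = M 1 3) ∧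
      (M 2 1 = -M 3 0 ∧ M 2 0 = M 3 1 ∧ M 2 3 = -M 3 2 ∧ M 2 2 = M 3 3) := by
    rw [commute_iff_eq, ← Matrix.ext_iff]
    simp only [Fin.forall_fin_succ, Matrix.mul_apply, Fin.sum_univ_four]
    simp
    grind
  have hJ : Commute M !![0, 0, -1, 0; 0, 0, 0, 1; 1, 0, 0, 0; 0, -1, 0, 0] ↔
      (M 0 2 = -M 2 0 ∧ M 0 3 = M 2 1 ∧ M 0 0 = M 2 2 ∧ M 0 1 = -M 2 3) ∧
      (M 1 2 = M 3 0 ∧ M 1 3 = -M 3 1 ∧ M 1 0 = -M 3 2 ∧ M 1 1 = M 3 3) := by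
    rw [commute_iff_eq, ← Matrix.ext_iff]
    simp only [Fin.forall_fin_succ, Matrix.mul_apply, Fin.sum_univ_four]
    simp
    grind
  rw [hI, hJ]
  constructor
  · rintro ⟨z, rfl⟩
    simp [quaternionToReal]
  · rintro h
    refine ⟨⟨M 0 0, M 1 0, M 0 2, M 3 0⟩, ?_⟩
    ext i j
    fin_cases i <;> fin_cases j <;> simp [quaternionToReal] <;> grind

/-- The twisted identity expresses commuting with the conjugate-linear operator `x ↦ !![0, -1; 1, 0]
*ᵥ conj x`, whose square is `-1`. -/
theorem mem_range_quaternionToComplex_iff (M : Matrix (Fin 2) (Fin 2) ℂ) :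
    M ∈ Set.range quaternionToComplex ↔
      M * !![0, -1; 1, 0] = !![0, -1; 1, 0] * M.map (starRingEnd ℂ) := by
  have key : M * !![0, -1; 1, 0] = !![0, -1; 1, 0] * M.map (starRingEnd ℂ) ↔
      M 1 0 = -starRingEnd ℂ (M 0 1) ∧ M 1 1 = starRingEnd ℂ (M 0 0) := by
    rw [← Matrix.ext_iff]
    simp only [Fin.forall_fin_two, Matrix.mul_apply, Fin.sum_univ_two]
    simp [Complex.ext_iff]
    grind
  rw [key]
  constructor
  · rintro ⟨z, rfl⟩
    simp [quaternionToComplex]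
  · rintro ⟨h1, h2⟩
    refine ⟨⟨(M 0 0).re, (M 0 0).im, (M 0 1).re, (M 0 1).im⟩, ?_⟩
    ext i j
    fin_cases i <;> fin_cases j <;> simp [quaternionToComplex, h1, h2]

end StandardForms

/-! ### Real matrices -/

section Real

variable {n : ℕ}

theorem real_map_op_smul (e : Module.End ℝ (Fin n → ℝ)) (q : ℝᵐᵒᵖ) (x : Fin n → ℝ) :
    e (q • x) = q • e x := by
  rw [← MulOpposite.op_unop q, op_smul_eq_smul, op_smul_eq_smul, map_smul]

theorem rightCentralizer_real (A : Set (Matrix (Fin n) (Fin n) ℝ)) :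
    rightCentralizer A = realCentralizer A := by
  ext c
  rw [mem_rightCentralizer_iff]
  exact ⟨fun h => h.1, fun h => ⟨h, fun q => LinearMap.ext fun x => real_map_op_smul c q x⟩⟩

theorem real_classification (hn : 0 < n) {A : NonUnitalSubalgebra ℝ (Matrix (Fin n) (Fin n) ℝ)}
    (hA : IsIrreducibleFamily (A : Set (Matrix (Fin n) (Fin n) ℝ))) :
    (A = ⊤ ∧ IsLeast (nonzeroRanks (A : Set (Matrix (Fin n) (Fin n) ℝ))) 1) ∨
    (∃ h : n = n / 2 * 2,
      IsSimilar (A : Set (Matrix (Fin n) (Fin n) ℝ)) (Set.range (blockMatrix h complexToReal)) ∧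
      IsLeast (nonzeroRanks (A : Set (Matrix (Fin n) (Fin n) ℝ))) 2) ∨
    ∃ h : n = n / 4 * 4,
      IsSimilar (A : Set (Matrix (Fin n) (Fin n) ℝ)) (Set.range (blockMatrix h quaternionToReal)) ∧
      IsLeast (nonzeroRanks (A : Set (Matrix (Fin n) (Fin n) ℝ))) 4 := by
  have hZ := fun x hx y (_ : y ∈ rightCentralizer (A : Set (Matrix (Fin n) (Fin n) ℝ))) hxy =>
    rightCentralizer_mul_eq_zero hA (x := x) (y := y) hx hxy
  rw [rightCentralizer_real] at hZ
  rcases frobenius hZ with h | ⟨J, hJ, hJJ, h⟩ | ⟨J, hJ, K, hK, hJJ, hKK, hKJ, h⟩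
  · left
    have htop : A = ⊤ := eq_top_iff.mpr fun b _ => hA.mem_of_commute_centralizer hn (h _)
    exact ⟨htop, isLeast_nonzeroRanks_one (isSimilar_refl _) ⟨0, hn⟩ (by simp [htop])⟩
  · right; left
    let φ := Complex.lift ⟨J, hJJ⟩
    have hdvd := finrank_dvd_of_algHom φ
    rw [Complex.finrank_real_complex, Module.finrank_fin_fun] at hdvd
    have hnd : n = n / 2 * 2 := (Nat.div_mul_cancel hdvd).symm
    -- The model complex structure, whose commutant is the block copy of the complex matrices.
    let J₀ : Module.End ℝ (Fin n → ℝ) :=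
      mulVecEnd (blockRingEquiv hnd (Matrix.scalar _ !![0, -1; 1, 0]))
    have hJ₀ : J₀ * J₀ = -1 := by
      rw [← map_mul, ← map_mul, ← map_mul,
        show (!![0, -1; 1, 0] * !![0, -1; 1, 0] : Matrix (Fin 2) (Fin 2) ℝ) = -1 by
          ext i j; fin_cases i <;> fin_cases j <;> simp]
      simp only [map_neg, map_one]
    obtain ⟨e, he⟩ := exists_intertwining φ (Complex.lift ⟨J₀, hJ₀⟩) rfl
    have heJ : ∀ x, e (J x) = J₀ (e x) := fun x => by
      simpa [φ, Complex.liftAux_apply] using he Complex.I x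
    have hAJ := mem_iff_of_generators hA hn hJ hJ (fun b hb _ => h _ hb)
    have hsim : IsSimilar (A : Set (Matrix (Fin n) (Fin n) ℝ))
        (Set.range (blockMatrix hnd complexToReal)) := by
      refine isSimilar_of_intertwining e (real_map_op_smul e.toLinearMap) heJ heJ hAJ fun b => ?_
      rw [and_self, commute_mulVecEnd_iff, commute_blockRingEquiv_scalar_iff,
        mem_range_blockMatrix_iff]
      exact forall₂_congr fun k l => mem_range_complexToReal_iff _
    refine ⟨hnd, hsim, isLeast_nonzeroRanks_of_block hn hnd ?_ ?_ hsim fun a ha ha0 => ?_⟩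
    · ext i j; fin_cases i <;> fin_cases j <;> simp [complexToReal]
    · intro h0
      simpa [complexToReal] using congrFun (congrFun h0 0) 0
    · have := finrank_le_mul_rightRank φ ha0
        (commute_complexLift hJJ (commute_of_mem_centralizer ha hJ))
      rwa [Complex.finrank_real_complex, Module.finrank_self, one_mul] at this
  · right; right
    let φ := quaternionLift J K hJJ hKK hKJ
    have hdvd := finrank_dvd_of_algHom φ
    rw [Quaternion.finrank_eq_four, Module.finrank_fin_fun] at hdvd
    have hnd : n = n / 4 * 4 := (Nat.div_mul_cancel hdvd).symm
    let T : Matrix (Fin 4) (Fin 4) ℝ →+* Module.End ℝ (Fin n → ℝ) :=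
      (mulVecEnd : _ →ₐ[ℝ] Module.End ℝ (Fin n → ℝ)).toRingHom.comp
        ((blockRingEquiv hnd).toRingHom.comp (Matrix.scalar _))
    let RI : Matrix (Fin 4) (Fin 4) ℝ := !![0, -1, 0, 0; 1, 0, 0, 0; 0, 0, 0, -1; 0, 0, 1, 0]
    let RJ : Matrix (Fin 4) (Fin 4) ℝ := !![0, 0, -1, 0; 0, 0, 0, 1; 1, 0, 0, 0; 0, -1, 0, 0]
    have hII : T RI * T RI = -1 := by
      rw [← map_mul, show RI * RI = -1 by
        ext i j
        fin_cases i <;> fin_cases j <;> simp [RI, Matrix.mul_apply, Fin.sum_univ_four],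
        map_neg, map_one]
    have hJJ' : T RJ * T RJ = -1 := by
      rw [← map_mul, show RJ * RJ = -1 by
        ext i j
        fin_cases i <;> fin_cases j <;> simp [RJ, Matrix.mul_apply, Fin.sum_univ_four],
        map_neg, map_one]
    have hJI : T RJ * T RI = -(T RI * T RJ) := by
      rw [← map_mul T, ← map_mul T, ← map_neg, show RJ * RI = -(RI * RJ) by
        ext i j
        fin_cases i <;> fin_cases j <;> simp [RI, RJ, Matrix.mul_apply, Fin.sum_univ_four]]
    obtain ⟨e, he⟩ := exists_intertwining φ (quaternionLift _ _ hII hJJ' hJI) rfl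
    have heJ : ∀ x, e (J x) = T RI (e x) := fun x => by
      have := he ⟨0, 1, 0, 0⟩ x
      rwa [quaternionLift_I, quaternionLift_I] at this
    have heK : ∀ x, e (K x) = T RJ (e x) := fun x => by
      have := he ⟨0, 0, 1, 0⟩ x
      rwa [quaternionLift_J, quaternionLift_J] at this
    have hAJ := mem_iff_of_generators hA hn hJ hK (fun b hb hb' => h _ hb hb')
    have hsim : IsSimilar (A : Set (Matrix (Fin n) (Fin n) ℝ))
        (Set.range (blockMatrix hnd quaternionToReal)) := by
      refine isSimilar_of_intertwining e (real_map_op_smul e.toLinearMap) heJ heK hAJ fun b => ?_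
      change _ ↔ Commute (mulVecEnd b) (mulVecEnd (blockRingEquiv hnd (Matrix.scalar _ RI))) ∧
        Commute (mulVecEnd b) (mulVecEnd (blockRingEquiv hnd (Matrix.scalar _ RJ)))
      rw [commute_mulVecEnd_iff, commute_blockRingEquiv_scalar_iff, commute_mulVecEnd_iff,
        commute_blockRingEquiv_scalar_iff, mem_range_blockMatrix_iff]
      simp only [mem_range_quaternionToReal_iff, forall_and, RI, RJ]
    refine ⟨hnd, hsim, isLeast_nonzeroRanks_of_block hn hnd ?_ ?_ hsim fun a ha ha0 => ?_⟩
    · ext i j; fin_cases i <;> fin_cases j <;> simp [quaternionToReal]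
    · intro h0
      simpa [quaternionToReal] using congrFun (congrFun h0 0) 0
    · have := finrank_le_mul_rightRank φ ha0
        (commute_quaternionLift hJJ hKK hKJ (commute_of_mem_centralizer ha hJ)
          (commute_of_mem_centralizer ha hK))
      rwa [Quaternion.finrank_eq_four, Module.finrank_self, one_mul] at this

end Real

/-! ### Complex matrices -/

section Complex

open MulOpposite

variable {n : ℕ}

/-- Entrywise complex conjugation of column vectors. -/
noncomputable def conjEnd : Module.End ℝ (Fin n → ℂ) :=
  Complex.conjAe.toLinearMap.compLeft (Fin n)

@[simp]
theorem conjEnd_apply (x : Fin n → ℂ) (i : Fin n) :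
    conjEnd x i = starRingEnd ℂ (x i) := rfl

theorem conjEnd_mul_conjEnd : (conjEnd * conjEnd : Module.End ℝ (Fin n → ℂ)) = 1 := by
  ext x i
  simp

theorem conjEnd_smul (z : ℂ) (x : Fin n → ℂ) :
    conjEnd (op z • x) = op (starRingEnd ℂ z) • conjEnd x := by
  ext i
  simp [mul_comm]

theorem conjEnd_mul_mulVecEnd (b : Matrix (Fin n) (Fin n) ℂ) :
    conjEnd * mulVecEnd b = mulVecEnd (b.map (starRingEnd ℂ)) * conjEnd := by
  refine LinearMap.ext fun x => funext fun i => ?_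
  simp [Matrix.mulVec, dotProduct]

theorem commute_mulVecEnd_mul_conjEnd_iff {b M : Matrix (Fin n) (Fin n) ℂ} :
    Commute (mulVecEnd b) (mulVecEnd M * conjEnd) ↔ b * M = M * b.map (starRingEnd ℂ) := by
  rw [commute_iff_eq, mul_assoc, conjEnd_mul_mulVecEnd, ← mul_assoc, ← mul_assoc, ← map_mul,
    ← map_mul, ← mulVecEnd_injective.eq_iff]
  refine ⟨fun h => ?_, fun h => by rw [h]⟩
  simpa [mul_assoc, conjEnd_mul_conjEnd] using congrArg (· * conjEnd) h

theorem mem_range_map_ofReal_iff (b : Matrix (Fin n) (Fin n) ℂ) :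
    (b ∈ Set.range fun Z : Matrix (Fin n) (Fin n) ℝ => Z.map (fun x : ℝ => (x : ℂ))) ↔
      Commute (mulVecEnd b) conjEnd := by
  have h := commute_mulVecEnd_mul_conjEnd_iff (b := b) (M := 1)
  rw [map_one, one_mul, mul_one, one_mul] at h
  rw [h]
  constructor
  · rintro ⟨Z, rfl⟩
    ext i j
    simp
  · intro hb
    refine ⟨b.map Complex.re, ?_⟩
    ext i j : 1
    exact Complex.conj_eq_iff_re.mp (congrFun (congrFun hb i) j).symm

theorem rightMul_complex (z : ℂ) :
    (rightMul (op z) : Module.End ℝ (Fin n → ℂ)) = z.re • 1 + z.im • rightMul (op Complex.I) := by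
  refine LinearMap.ext fun x => funext fun i => ?_
  simp only [rightMul_apply, LinearMap.add_apply, LinearMap.smul_apply, Module.End.one_apply,
    Pi.add_apply, Pi.smul_apply, op_smul_eq_mul, Complex.real_smul]
  nth_rewrite 1 [← Complex.re_add_im z]
  ring

theorem rightMul_I_mul_self :
    (rightMul (op Complex.I) * rightMul (op Complex.I) : Module.End ℝ (Fin n → ℂ)) = -1 := by
  rw [← map_mul, ← op_mul, Complex.I_mul_I, op_neg, op_one, map_neg, map_one]

theorem map_op_smul_of_commute {f : Module.End ℝ (Fin n → ℂ)}
    (hf : Commute f (rightMul (op Complex.I))) (q : ℂᵐᵒᵖ) (x : Fin n → ℂ) :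
    f (q • x) = q • f x := by
  have : Commute f (rightMul (op (unop q))) := by
    rw [rightMul_complex]
    exact ((Commute.one_right f).smul_right _).add_right (hf.smul_right _)
  exact LinearMap.congr_fun this.eq x

theorem map_op_smul_of_anticommute {f : Module.End ℝ (Fin n → ℂ)}
    (hf : f * rightMul (op Complex.I) = -(rightMul (op Complex.I) * f)) (z : ℂ) (x : Fin n → ℂ) :
    f (op z • x) = op (starRingEnd ℂ z) • f x := by
  have : f * rightMul (op z) = rightMul (op (starRingEnd ℂ z)) * f := by
    rw [rightMul_complex z, rightMul_complex (starRingEnd ℂ z), mul_add, add_mul, mul_smul_comm,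
      mul_smul_comm, hf, smul_mul_assoc, smul_mul_assoc, Complex.conj_re, Complex.conj_im, mul_one, one_mul]
    module
  exact LinearMap.congr_fun this x

theorem complex_classification (hn : 0 < n)
    {A : NonUnitalSubalgebra ℝ (Matrix (Fin n) (Fin n) ℂ)}
    (hA : IsIrreducibleFamily (A : Set (Matrix (Fin n) (Fin n) ℂ))) :
    (A = ⊤ ∧ IsLeast (nonzeroRanks (A : Set (Matrix (Fin n) (Fin n) ℂ))) 1) ∨
    (IsSimilar (A : Set (Matrix (Fin n) (Fin n) ℂ))
        (Set.range fun Z : Matrix (Fin n) (Fin n) ℝ => Z.map (fun x : ℝ => (x : ℂ))) ∧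
      IsLeast (nonzeroRanks (A : Set (Matrix (Fin n) (Fin n) ℂ))) 1) ∨
    ∃ h : n = n / 2 * 2,
      IsSimilar (A : Set (Matrix (Fin n) (Fin n) ℂ))
        (Set.range (blockMatrix h quaternionToComplex)) ∧
      IsLeast (nonzeroRanks (A : Set (Matrix (Fin n) (Fin n) ℂ))) 2 := by
  set C := realCentralizer (A : Set (Matrix (Fin n) (Fin n) ℂ)) with hC
  set I : Module.End ℝ (Fin n → ℂ) := rightMul (op Complex.I) with hI
  have hIC : I ∈ C := rightMul_mem_realCentralizer _ _
  have hII : I * I = -1 := rightMul_I_mul_self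
  have hright : ∀ x ∈ C, Commute x I →
      x ∈ rightCentralizer (A : Set (Matrix (Fin n) (Fin n) ℂ)) := fun x hx hxI =>
    mem_rightCentralizer_iff.mpr ⟨hx, fun q => LinearMap.ext fun v => map_op_smul_of_commute hxI q v⟩
  -- Commuting with `I` means complex-linear, so such `x` lie in a domain in which `I` is central.
  have hcomm : ∀ x ∈ C, Commute x I → ∃ a b : ℝ, x = a • 1 + b • I := fun x hx hxI =>
    exists_eq_of_commute (fun x hx y _ hxy => rightCentralizer_mul_eq_zero hA hx hxy)
      (hright I hIC (Commute.refl I)) hII (hright x hx hxI) hxI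
  -- Anticommuting with `I` means conjugate-linear; the kernel is still a complex subspace.
  have hanti : ∀ x ∈ C, x * I = -(I * x) → x * x = 0 → x = 0 := fun x hx hxI hxx => by
    refine (or_self_iff.mp (eq_zero_or_eq_zero_of_mul_eq_zero hA hx (fun q v hv => ?_) hxx))
    have := map_op_smul_of_anticommute hxI (unop q) v
    rwa [hv, smul_zero, op_unop] at this
  rcases eq_or_exists_anticommute hIC hII hcomm hanti with h | ⟨K, hK, hKI, hKK | hKK, h⟩
  · left
    have htop : A = ⊤ := SetLike.ext fun b => ⟨fun _ => NonUnitalAlgebra.mem_top,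
      fun _ => hA.mem_of_commute_centralizer hn (h _ (commute_mulVecEnd_rightMul b _))⟩
    exact ⟨htop, isLeast_nonzeroRanks_one (isSimilar_refl _) ⟨0, hn⟩ (by simp [htop])⟩
  · right; left
    have hKs := map_op_smul_of_anticommute hKI
    have hAK := mem_iff_of_generators hA hn hK hK
      (fun b hb _ => h _ (commute_mulVecEnd_rightMul b _) hb)
    -- `K` is a conjugation: `v + K v` and `(v - K v) i` are both fixed by it, and together they
    -- recover `v`.
    have hspan : Submodule.span ℂᵐᵒᵖ {x : Fin n → ℂ | K x = x} = ⊤ := by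
      refine eq_top_iff.mpr fun v _ => ?_
      have hKKv : ∀ v, K (K v) = v := fun v => LinearMap.congr_fun hKK v
      have h1 : v + K v ∈ Submodule.span ℂᵐᵒᵖ {x : Fin n → ℂ | K x = x} :=
        Submodule.subset_span (by simp [hKKv, add_comm])
      have h2 : op Complex.I • (v - K v) ∈ Submodule.span ℂᵐᵒᵖ {x : Fin n → ℂ | K x = x} :=
        Submodule.subset_span (by
          change K _ = _
          rw [hKs, map_sub, hKKv, Complex.conj_I, op_neg, neg_smul, ← smul_neg,
            neg_sub])
      have h3 : v = op (2⁻¹ : ℂ) • ((v + K v) - op Complex.I • (op Complex.I • (v - K v))) := by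
        rw [smul_smul, ← op_mul, Complex.I_mul_I]
        ext i
        simp
        ring
      rw [h3]
      exact Submodule.smul_mem _ _ (Submodule.sub_mem _ h1 (Submodule.smul_mem _ _ h2))
    obtain ⟨e, he⟩ := exists_linearEquiv_of_span_eq_top hspan
    let e' : (Fin n → ℂ) ≃ₗ[ℝ] (Fin n → ℂ) := e.restrictScalars ℝ
    -- Both sides are conjugate-linear and fix the standard basis.
    have heK : e'.toLinearMap ∘ₗ K ∘ₗ e'.symm.toLinearMap = conjEnd := by
      refine end_ext (starRingEnd ℂ) (fun q x => ?_) conjEnd_smul fun k => ?_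
      · change e (K (e.symm (op q • x))) = op _ • e (K (e.symm x))
        rw [map_smul, hKs, map_smul]
      · change e (K (e.symm _)) = _
        rw [show K (e.symm (Pi.single k 1)) = _ from he k, LinearEquiv.apply_symm_apply]
        ext i
        by_cases hik : i = k
        · subst hik; simp
        · simp [hik]
    have hsim := isSimilar_of_intertwining e' (fun q x => e.map_smul q x)
      (J := K) (K := K) (J₀ := conjEnd) (K₀ := conjEnd)
      (fun x => by simp [← heK]) (fun x => by simp [← heK]) hAK
      (B := Set.range fun Z : Matrix (Fin n) (Fin n) ℝ => Z.map (fun x : ℝ => (x : ℂ)))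
      (fun b => by rw [mem_range_map_ofReal_iff, and_self])
    refine ⟨hsim, isLeast_nonzeroRanks_one hsim ⟨0, hn⟩ ⟨Matrix.single ⟨0, hn⟩ ⟨0, hn⟩ 1, ?_⟩⟩
    exact (Matrix.map_single _ _ _ Complex.ofRealHom).trans (by simp)
  · right; right
    let φ := quaternionLift I K hII hKK hKI
    have hdvd := finrank_dvd_of_algHom φ
    have hfin : Module.finrank ℝ (Fin n → ℂ) = 2 * n := by
      rw [Module.finrank_pi_fintype]; simp [mul_comm]
    rw [Quaternion.finrank_eq_four, hfin] at hdvd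
    have hnd : n = n / 2 * 2 := by omega
    let M : Matrix (Fin n) (Fin n) ℂ := blockRingEquiv hnd (Matrix.scalar _ !![0, -1; 1, 0])
    -- The model quaternionic structure: conjugate-linear with square `-1` because `M` is real and
    -- `M * M = -1`.
    let K₀ : Module.End ℝ (Fin n → ℂ) := mulVecEnd M * conjEnd
    have hmapM : ∀ b : Matrix (Fin n) (Fin n) ℂ, b.map (starRingEnd ℂ) =
        blockRingEquiv hnd (((blockRingEquiv hnd).symm b).map fun X => X.map (starRingEnd ℂ)) := by
      intro b
      obtain ⟨Z, rfl⟩ := (blockRingEquiv hnd).surjective b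
      rw [RingEquiv.symm_apply_apply]
      rfl
    have hM : M.map (starRingEnd ℂ) = M := by
      rw [hmapM, RingEquiv.symm_apply_apply]
      congr 1
      refine Matrix.ext fun k l => ?_
      by_cases hkl : k = l
      · subst hkl
        ext i j
        fin_cases i <;> fin_cases j <;> simp
      · ext i j
        simp [hkl]
    have hMM : M * M = -1 := by
      rw [← map_mul, ← map_mul,
        show (!![0, -1; 1, 0] * !![0, -1; 1, 0] : Matrix (Fin 2) (Fin 2) ℂ) = -1 by
          ext i j; fin_cases i <;> fin_cases j <;> simp]
      simp only [map_neg, map_one]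
    have hK₀K₀ : K₀ * K₀ = -1 := by
      calc K₀ * K₀ = mulVecEnd M * (conjEnd * mulVecEnd M) * conjEnd := by
            simp only [K₀, mul_assoc]
        _ = mulVecEnd (M * M) * (conjEnd * conjEnd) := by
            rw [conjEnd_mul_mulVecEnd, hM, map_mul]; simp only [mul_assoc]
        _ = -1 := by rw [hMM, conjEnd_mul_conjEnd, mul_one, map_neg, map_one]
    have hK₀I : K₀ * I = -(I * K₀) := by
      refine LinearMap.ext fun x => ?_
      change M *ᵥ conjEnd (op Complex.I • x) = -(op Complex.I • (M *ᵥ conjEnd x))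
      rw [conjEnd_smul, Complex.conj_I, op_neg, neg_smul, Matrix.mulVec_neg, Matrix.mulVec_smul]
    obtain ⟨e, he⟩ := exists_intertwining φ (quaternionLift I K₀ hII hK₀K₀ hK₀I) rfl
    have heI : ∀ x, e (I x) = I (e x) := fun x => by
      have := he ⟨0, 1, 0, 0⟩ x
      rwa [quaternionLift_I, quaternionLift_I] at this
    have heK : ∀ x, e (K x) = K₀ (e x) := fun x => by
      have := he ⟨0, 0, 1, 0⟩ x
      rwa [quaternionLift_J, quaternionLift_J] at this
    have hAK := mem_iff_of_generators hA hn hK hK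
      (fun b hb _ => h _ (commute_mulVecEnd_rightMul b _) hb)
    have hsim : IsSimilar (A : Set (Matrix (Fin n) (Fin n) ℂ))
        (Set.range (blockMatrix hnd quaternionToComplex)) := by
      -- The quaternionic intertwiner respects `I`, so it is complex-linear and comes from a complex
      -- matrix.
      refine isSimilar_of_intertwining e
        (map_op_smul_of_commute (f := e.toLinearMap) (LinearMap.ext heI)) heK heK hAK fun b => ?_
      rw [and_self, commute_mulVecEnd_mul_conjEnd_iff, mem_range_blockMatrix_iff, hmapM,
        ← (blockRingEquiv hnd).symm.injective.eq_iff]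
      simp only [M, map_mul, RingEquiv.symm_apply_apply]
      rw [← Matrix.ext_iff]
      refine forall₂_congr fun k l => ?_
      rw [mem_range_quaternionToComplex_iff]
      simp [Matrix.scalar_apply]
    refine ⟨hnd, hsim, isLeast_nonzeroRanks_of_block hn hnd ?_ ?_ hsim fun a ha ha0 => ?_⟩
    · ext i j; fin_cases i <;> fin_cases j <;> simp [quaternionToComplex, Complex.ext_iff]
    · intro h0
      simpa [quaternionToComplex, Complex.ext_iff] using congrFun (congrFun h0 0) 0
    · have := finrank_le_mul_rightRank φ ha0
        (commute_quaternionLift hII hKK hKI (commute_of_mem_centralizer ha hIC)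
          (commute_of_mem_centralizer ha hK))
      rw [Quaternion.finrank_eq_four, Complex.finrank_real_complex] at this
      omega

end Complex

/-! ### Quaternionic matrices -/

section Quaternion

open MulOpposite

variable {n : ℕ}

/-- The quaternion unit `i`. -/
def quatI : ℍ[ℝ] := ⟨0, 1, 0, 0⟩

/-- The quaternion unit `j`. -/
def quatJ : ℍ[ℝ] := ⟨0, 0, 1, 0⟩

@[simp]
theorem re_quatI : quatI.re = 0 := rfl

@[simp]
theorem imI_quatI : quatI.imI = 1 := rfl

@[simp]
theorem imJ_quatI : quatI.imJ = 0 := rfl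

@[simp]
theorem imK_quatI : quatI.imK = 0 := rfl

@[simp]
theorem re_quatJ : quatJ.re = 0 := rfl

@[simp]
theorem imI_quatJ : quatJ.imI = 0 := rfl

@[simp]
theorem imJ_quatJ : quatJ.imJ = 1 := rfl

@[simp]
theorem imK_quatJ : quatJ.imK = 0 := rfl

theorem quatI_mul_self : quatI * quatI = -1 := by ext <;> simp

theorem quatJ_mul_self : quatJ * quatJ = -1 := by ext <;> simp

theorem quatJ_mul_quatI : quatJ * quatI = -(quatI * quatJ) := by ext <;> simp

theorem quaternion_eq (q : ℍ[ℝ]) :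
    q = q.re • 1 + q.imI • quatI + q.imJ • quatJ + q.imK • (quatI * quatJ) := by
  ext <;> simp

theorem commute_quatI_iff (q : ℍ[ℝ]) : Commute q quatI ↔ ∃ z : ℂ, (z : ℍ[ℝ]) = q := by
  have h : Commute q quatI ↔ q.imJ = 0 ∧ q.imK = 0 := by
    rw [commute_iff_eq, Quaternion.ext_iff]
    simp
    grind
  rw [h]
  constructor
  · rintro ⟨h1, h2⟩
    exact ⟨⟨q.re, q.imI⟩, by ext <;> simp [h1, h2]⟩
  · rintro ⟨z, rfl⟩
    simp

theorem commute_quatI_quatJ_iff (q : ℍ[ℝ]) :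
    Commute q quatI ∧ Commute q quatJ ↔ ∃ x : ℝ, (x : ℍ[ℝ]) = q := by
  have h : Commute q quatJ ↔ q.imI = 0 ∧ q.imK = 0 := by
    rw [commute_iff_eq, Quaternion.ext_iff]
    simp
    grind
  rw [h, commute_quatI_iff]
  constructor
  · rintro ⟨⟨z, rfl⟩, h1, -⟩
    exact ⟨z.re, by ext <;> simp_all⟩
  · rintro ⟨x, rfl⟩
    exact ⟨⟨x, by simp⟩, by simp⟩

theorem rightMul_quaternion (q : ℍ[ℝ]) :
    (rightMul (op q) : Module.End ℝ (Fin n → ℍ[ℝ])) = q.re • 1 + q.imI • rightMul (op quatI) +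
      q.imJ • rightMul (op quatJ) + q.imK • (rightMul (op quatJ) * rightMul (op quatI)) := by
  nth_rewrite 1 [quaternion_eq q]
  simp only [op_add, op_smul, op_one, map_add, map_smul, map_one, op_mul, map_mul]

theorem rightMul_mul_self {q : ℍ[ℝ]} (hq : q * q = -1) :
    (rightMul (op q) * rightMul (op q) : Module.End ℝ (Fin n → ℍ[ℝ])) = -1 := by
  rw [← map_mul, ← op_mul, hq, op_neg, op_one, map_neg, map_one]

theorem rightMul_mul_rightMul {p q : ℍ[ℝ]} (hpq : p * q = -(q * p)) :
    (rightMul (op q) * rightMul (op p) : Module.End ℝ (Fin n → ℍ[ℝ])) =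
      -(rightMul (op p) * rightMul (op q)) := by
  rw [← map_mul, ← op_mul, hpq, op_neg, map_neg, op_mul, map_mul]

theorem map_op_smul_of_commute_units {f : Module.End ℝ (Fin n → ℍ[ℝ])}
    (hI : Commute f (rightMul (op quatI))) (hJ : Commute f (rightMul (op quatJ))) (q : ℍ[ℝ]ᵐᵒᵖ) :
    Commute f (rightMul q) := by
  rw [← op_unop q, rightMul_quaternion]
  exact ((((Commute.one_right f).smul_right _).add_right (hI.smul_right _)).add_right
    (hJ.smul_right _)).add_right ((hJ.mul_right hI).smul_right _)

/-- Right multiplications by `i` and `j` lie in the commutant, and their joint commutant inside it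
is its right-linear part. -/
theorem mem_realCentralizer_commute {A : Set (Matrix (Fin n) (Fin n) ℍ[ℝ])}
    {f : Module.End ℝ (Fin n → ℍ[ℝ])} (hf : ∀ q, Commute f (rightMul q))
    (h : ∀ c ∈ rightCentralizer A, Commute f c) : ∀ c ∈ realCentralizer A, Commute f c := by
  refine commute_of_commute_centralizer (rightMul_mem_realCentralizer A (op quatI))
    (rightMul_mem_realCentralizer A (op quatJ)) (rightMul_mul_self quatI_mul_self)
    (rightMul_mul_self quatJ_mul_self) (rightMul_mul_rightMul (by rw [quatJ_mul_quatI, neg_neg]))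
    (hf _) (hf _) fun c hc hI hJ => ?_
  exact h c (mem_rightCentralizer_iff.mpr ⟨hc, map_op_smul_of_commute_units hI hJ⟩)

/-- A subspace is contained in `U` if its `-1`-eigenvectors for an involution `X` are, provided
`X` anticommutes with right multiplication by a square root of `-1`. -/
theorem mem_of_involution {X : Module.End ℝ (Fin n → ℍ[ℝ])} {q : ℍ[ℝ]} (hX : X * X = 1)
    (hq : q * q = -1) (hqX : X * rightMul (op q) = -(rightMul (op q) * X))
    {N : Submodule ℝ (Fin n → ℍ[ℝ])} (hNX : ∀ v ∈ N, X v ∈ N) (hNq : ∀ v ∈ N, op q • v ∈ N)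
    {U : Submodule ℍ[ℝ]ᵐᵒᵖ (Fin n → ℍ[ℝ])} (hU : ∀ v ∈ N, X v = -v → v ∈ U) {v : Fin n → ℍ[ℝ]}
    (hv : v ∈ N) : v ∈ U := by
  have hXX : ∀ v, X (X v) = v := fun v => LinearMap.congr_fun hX v
  have hXq : ∀ v, X (op q • v) = -(op q • X v) := fun v => LinearMap.congr_fun hqX v
  -- Right multiplication by `q` swaps the `±1` eigenspaces of `X`, so the `+1` part of `v` is a
  -- right multiple of a `-1` eigenvector.
  have h1 : v - X v ∈ U := hU _ (N.sub_mem hv (hNX v hv)) (by rw [map_sub, hXX]; abel)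
  have h2 : op q • (v + X v) ∈ U := hU _ (hNq _ (N.add_mem hv (hNX v hv))) (by
    rw [hXq, map_add, hXX, add_comm])
  have h3 : v = (2⁻¹ : ℝ) • ((v - X v) - op q • op q • (v + X v)) := by
    rw [smul_smul (op q), ← op_mul, hq, op_neg, op_one, neg_smul, one_smul]
    module
  rw [h3]
  exact U.smul_of_tower_mem _ (U.sub_mem h1 (U.smul_mem _ h2))

section Anticommute

variable {R : Type*} [Ring R] {a b c d : R}

theorem mul_mul_self_eq_one_of_commute (h : Commute b a) (ha : a * a = -1) (hb : b * b = -1) :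
    (a * b) * (a * b) = 1 := by
  rw [mul_assoc, ← mul_assoc b, h.eq, mul_assoc, hb, ← mul_assoc, ha, neg_mul_neg, one_mul]

theorem mul_mul_eq_neg_of_commute (h : Commute b c) (hac : a * c = -(c * a)) :
    (a * b) * c = -(c * (a * b)) := by
  rw [mul_assoc, h.eq, ← mul_assoc, hac, neg_mul, mul_assoc]

theorem commute_mul_mul_of_anticommute (hda : Commute d a) (hbc : Commute b c)
    (hca : c * a = -(a * c)) (hdb : d * b = -(b * d)) : Commute (c * d) (a * b) := by
  rw [commute_iff_eq, mul_assoc, ← mul_assoc d, hda.eq, mul_assoc a, hdb, ← mul_assoc, hca,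
    neg_mul_neg, mul_assoc a, ← mul_assoc c, ← hbc.eq]
  simp only [mul_assoc]

end Anticommute

section Units

variable {J K : Module.End ℝ (Fin n → ℍ[ℝ])}

theorem apply_eq_of_rightMul_mul_apply_eq_neg {q : ℍ[ℝ]} (hq : q * q = -1)
    {J : Module.End ℝ (Fin n → ℍ[ℝ])} {v : Fin n → ℍ[ℝ]}
    (h : (rightMul (op q) * J : Module.End ℝ (Fin n → ℍ[ℝ])) v = -v) : J v = op q • v := by
  have h' : op q • J v = -v := h
  have := congrArg (op q • ·) h'
  simp only [smul_smul, ← op_mul, hq, op_neg, op_one, neg_smul, one_smul, smul_neg] at this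
  exact neg_injective this

/-- `v ↦ (J v) i` is an involution whose `-1` eigenvectors are the required vectors; right
multiplication by `j` anticommutes with it. -/
theorem span_eq_top_of_sq_eq_neg_one (hJ : ∀ q, Commute J (rightMul q)) (hJJ : J * J = -1) :
    Submodule.span ℍ[ℝ]ᵐᵒᵖ {v : Fin n → ℍ[ℝ] | J v = op quatI • v} = ⊤ := by
  refine eq_top_iff.mpr fun v _ => ?_
  exact mem_of_involution
    (mul_mul_self_eq_one_of_commute (hJ _) (rightMul_mul_self quatI_mul_self) hJJ) quatJ_mul_self
    (mul_mul_eq_neg_of_commute (hJ _) (rightMul_mul_rightMul quatJ_mul_quatI)) (N := ⊤)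
    (fun _ _ => trivial) (fun _ _ => trivial)
    (fun v _ hv => Submodule.subset_span (apply_eq_of_rightMul_mul_apply_eq_neg quatI_mul_self hv))
    trivial

/-- `X` and `Y` are commuting involutions whose common `-1` eigenvectors are required. Right
multiplication by `i` reduces to the `-1` eigenspace of `Y`; right multiplication by `j` preserves
that eigenspace and anticommutes with `X`. -/
theorem span_eq_top_of_anticommute (hJ : ∀ q, Commute J (rightMul q)) (hJJ : J * J = -1)
    (hK : ∀ q, Commute K (rightMul q)) (hKK : K * K = -1) (hKJ : K * J = -(J * K)) :
    Submodule.span ℍ[ℝ]ᵐᵒᵖ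
      {v : Fin n → ℍ[ℝ] | J v = op quatI • v ∧ K v = op quatJ • v} = ⊤ := by
  set X := rightMul (op quatI) * J with hX
  set Y := rightMul (op quatJ) * K with hY
  have hXY : Y * X = X * Y := commute_mul_mul_of_anticommute (hK _) (hJ _)
    (rightMul_mul_rightMul (by rw [quatJ_mul_quatI, neg_neg])) hKJ
  have hYJ : Y * rightMul (op quatJ) = rightMul (op quatJ) * Y := by
    rw [hY, mul_assoc, (hK _).eq]
  refine eq_top_iff.mpr fun v _ => ?_
  refine mem_of_involution
    (mul_mul_self_eq_one_of_commute (hK _) (rightMul_mul_self quatJ_mul_self) hKK) quatI_mul_self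
    (mul_mul_eq_neg_of_commute (hK _)
      (rightMul_mul_rightMul (by rw [quatJ_mul_quatI, neg_neg]))) (N := ⊤)
    (fun _ _ => trivial) (fun _ _ => trivial) (fun v _ hv => ?_) trivial
  refine mem_of_involution
    (mul_mul_self_eq_one_of_commute (hJ _) (rightMul_mul_self quatI_mul_self) hJJ) quatJ_mul_self
    (mul_mul_eq_neg_of_commute (hJ _) (rightMul_mul_rightMul quatJ_mul_quatI))
    (N := LinearMap.ker (Y + 1)) (fun v hv => ?_)
    (fun v hv => ?_) (fun v hv hXv => Submodule.subset_span
      (show v ∈ {v : Fin n → ℍ[ℝ] | J v = op quatI • v ∧ K v = op quatJ • v} from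
        ⟨apply_eq_of_rightMul_mul_apply_eq_neg quatI_mul_self hXv,
          apply_eq_of_rightMul_mul_apply_eq_neg quatJ_mul_self
            (eq_neg_of_add_eq_zero_left (LinearMap.mem_ker.mp hv))⟩))
    (by rw [LinearMap.mem_ker, LinearMap.add_apply, hv, Module.End.one_apply, neg_add_cancel])
  · have hv' : Y v + v = 0 := hv
    change Y (X v) + X v = 0
    rw [show Y (X v) = X (Y v) from LinearMap.congr_fun hXY v, ← map_add, hv', map_zero]
  · have hv' : Y v + v = 0 := hv
    change Y (op quatJ • v) + op quatJ • v = 0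
    rw [show Y (op quatJ • v) = op quatJ • Y v from LinearMap.congr_fun hYJ v, ← smul_add, hv',
      smul_zero]

end Units

theorem scalar_mulVec_apply (q : ℍ[ℝ]) (x : Fin n → ℍ[ℝ]) :
    Matrix.scalar (Fin n) q *ᵥ x = fun i => q * x i := by
  ext1 i
  simp [Matrix.scalar_apply, Matrix.mulVec_diagonal]

/-- If `J` is right-linear and a right-linear automorphism `e` takes vectors on which `J` is right
multiplication by `q` to the standard basis, then `e` takes `J` to left multiplication by `q`. -/
theorem intertwine_scalar {J : Module.End ℝ (Fin n → ℍ[ℝ])} (hJ : ∀ q, Commute J (rightMul q))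
    {q : ℍ[ℝ]} (e : (Fin n → ℍ[ℝ]) ≃ₗ[ℍ[ℝ]ᵐᵒᵖ] (Fin n → ℍ[ℝ]))
    (he : ∀ k, J (e.symm (Pi.single k 1)) = op q • e.symm (Pi.single k 1)) (x : Fin n → ℍ[ℝ]) :
    e.restrictScalars ℝ (J x) = mulVecEnd (Matrix.scalar (Fin n) q) (e.restrictScalars ℝ x) := by
  let e' : (Fin n → ℍ[ℝ]) ≃ₗ[ℝ] (Fin n → ℍ[ℝ]) := e.restrictScalars ℝ
  have h : e'.toLinearMap ∘ₗ J ∘ₗ e'.symm.toLinearMap = mulVecEnd (Matrix.scalar (Fin n) q) := by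
    refine end_ext id (fun p x => ?_)
      (fun p x => LinearMap.congr_fun (commute_mulVecEnd_rightMul _ (op p)).eq x) fun k => ?_
    · change e (J (e.symm (op p • x))) = op p • e (J (e.symm x))
      rw [map_smul, show J (op p • e.symm x) = op p • J (e.symm x) from
        LinearMap.congr_fun (hJ (op p)).eq _, map_smul]
    · change e (J (e.symm _)) = _
      rw [he, map_smul, LinearEquiv.apply_symm_apply, mulVecEnd_apply, scalar_mulVec_apply]
      ext1 i
      by_cases hik : i = k
      · subst hik; simp
      · simp [hik]
  rw [← h]
  simp [e']

theorem quaternion_classification (hn : 0 < n)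
    {A : NonUnitalSubalgebra ℝ (Matrix (Fin n) (Fin n) ℍ[ℝ])}
    (hA : IsIrreducibleFamily (A : Set (Matrix (Fin n) (Fin n) ℍ[ℝ]))) :
    IsLeast (nonzeroRanks (A : Set (Matrix (Fin n) (Fin n) ℍ[ℝ]))) 1 ∧
    (A = ⊤ ∨
      IsSimilar (A : Set (Matrix (Fin n) (Fin n) ℍ[ℝ]))
        (Set.range fun Z : Matrix (Fin n) (Fin n) ℂ => Z.map (fun z : ℂ => (z : ℍ[ℝ]))) ∨
      IsSimilar (A : Set (Matrix (Fin n) (Fin n) ℍ[ℝ]))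
        (Set.range fun Z : Matrix (Fin n) (Fin n) ℝ => Z.map (fun x : ℝ => (x : ℍ[ℝ])))) := by
  set Z := rightCentralizer (A : Set (Matrix (Fin n) (Fin n) ℍ[ℝ])) with hZdef
  have hZ : ∀ x ∈ Z, ∀ y ∈ Z, x * y = 0 → x = 0 ∨ y = 0 := fun x hx y _ hxy =>
    rightCentralizer_mul_eq_zero hA hx hxy
  have hext : ∀ b, (∀ c ∈ Z, Commute (mulVecEnd b) c) →
      ∀ c ∈ realCentralizer (A : Set (Matrix (Fin n) (Fin n) ℍ[ℝ])), Commute (mulVecEnd b) c :=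
    fun b hb => mem_realCentralizer_commute (commute_mulVecEnd_rightMul b) hb
  rcases frobenius hZ with h | ⟨J, hJ, hJJ, h⟩ | ⟨J, hJ, K, hK, hJJ, hKK, hKJ, h⟩
  · have htop : A = ⊤ := SetLike.ext fun b => ⟨fun _ => NonUnitalAlgebra.mem_top,
      fun _ => hA.mem_of_commute_centralizer hn (hext b (h _))⟩
    exact ⟨isLeast_nonzeroRanks_one (isSimilar_refl _) ⟨0, hn⟩ (by simp [htop]), Or.inl htop⟩
  · obtain ⟨hJC, hJR⟩ := mem_rightCentralizer_iff.mp hJ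
    obtain ⟨e, he⟩ := exists_linearEquiv_of_span_eq_top (span_eq_top_of_sq_eq_neg_one hJR hJJ)
    have heJ := intertwine_scalar hJR e he
    have hsim : IsSimilar (A : Set (Matrix (Fin n) (Fin n) ℍ[ℝ]))
        (Set.range fun Z : Matrix (Fin n) (Fin n) ℂ => Z.map (fun z : ℂ => (z : ℍ[ℝ]))) := by
      refine isSimilar_of_intertwining (e.restrictScalars ℝ) (fun q x => e.map_smul q x) heJ heJ
        (mem_iff_of_generators hA hn hJC hJC fun b hb _ => hext b (h _ hb)) fun b => ?_
      rw [and_self, commute_mulVecEnd_iff, scalar_commute_iff_forall]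
      simp only [commute_quatI_iff]
      constructor
      · rintro ⟨Z, rfl⟩ i j
        exact ⟨Z i j, rfl⟩
      · intro hb
        choose Z hZ using hb
        exact ⟨Matrix.of Z, Matrix.ext hZ⟩
    refine ⟨isLeast_nonzeroRanks_one hsim ⟨0, hn⟩ ⟨Matrix.single ⟨0, hn⟩ ⟨0, hn⟩ 1, ?_⟩,
      Or.inr (Or.inl hsim)⟩
    exact (Matrix.map_single _ _ _ Quaternion.ofComplex).trans (by simp)
  · obtain ⟨hJC, hJR⟩ := mem_rightCentralizer_iff.mp hJ
    obtain ⟨hKC, hKR⟩ := mem_rightCentralizer_iff.mp hK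
    obtain ⟨e, he⟩ := exists_linearEquiv_of_span_eq_top
      (span_eq_top_of_anticommute hJR hJJ hKR hKK hKJ)
    have hsim : IsSimilar (A : Set (Matrix (Fin n) (Fin n) ℍ[ℝ]))
        (Set.range fun Z : Matrix (Fin n) (Fin n) ℝ => Z.map (fun x : ℝ => (x : ℍ[ℝ]))) := by
      refine isSimilar_of_intertwining (e.restrictScalars ℝ) (fun q x => e.map_smul q x)
        (intertwine_scalar hJR e fun k => (he k).1) (intertwine_scalar hKR e fun k => (he k).2)
        (mem_iff_of_generators hA hn hJC hKC fun b hb hb' => hext b (h _ hb hb')) fun b => ?_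
      rw [commute_mulVecEnd_iff, scalar_commute_iff_forall, commute_mulVecEnd_iff,
        scalar_commute_iff_forall]
      simp only [← forall_and, commute_quatI_quatJ_iff]
      constructor
      · rintro ⟨Z, rfl⟩ i j
        exact ⟨Z i j, rfl⟩
      · intro hb
        choose Z hZ using hb
        exact ⟨Matrix.of Z, Matrix.ext hZ⟩
    refine ⟨isLeast_nonzeroRanks_one hsim ⟨0, hn⟩ ⟨Matrix.single ⟨0, hn⟩ ⟨0, hn⟩ 1, ?_⟩,
      Or.inr (Or.inr hsim)⟩
    exact (Matrix.map_single _ _ _ (algebraMap ℝ ℍ[ℝ])).trans (by simp)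

end Quaternion

end BurnsideType

/-! ### Assembling the three cases -/

theorem theorem1p2 (n : ℕ) (hn : 0 < n) :
    -- real algebras of real matrices
    (∀ A : NonUnitalSubalgebra ℝ (Matrix (Fin n) (Fin n) ℝ),
      BurnsideType.IsIrreducibleFamily (A : Set (Matrix (Fin n) (Fin n) ℝ)) →
      ∃ r : ℕ, IsLeast (BurnsideType.nonzeroRanks (A : Set (Matrix (Fin n) (Fin n) ℝ))) r ∧
        r ∣ n ∧ (r = 1 ∨ r = 2 ∨ r = 4) ∧
        (r = 1 → A = ⊤) ∧
        (r = 2 → ∃ h : n = n / 2 * 2,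
          BurnsideType.IsSimilar (A : Set (Matrix (Fin n) (Fin n) ℝ))
            (Set.range (BurnsideType.blockMatrix h BurnsideType.complexToReal))) ∧
        (r = 4 → ∃ h : n = n / 4 * 4,
          BurnsideType.IsSimilar (A : Set (Matrix (Fin n) (Fin n) ℝ))
            (Set.range (BurnsideType.blockMatrix h BurnsideType.quaternionToReal))) ∧
        (A = ⊤ ↔ r = 1)) ∧
    -- real algebras of complex matrices
    (∀ A : NonUnitalSubalgebra ℝ (Matrix (Fin n) (Fin n) ℂ),
      BurnsideType.IsIrreducibleFamily (A : Set (Matrix (Fin n) (Fin n) ℂ)) →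
      ∃ r : ℕ, IsLeast (BurnsideType.nonzeroRanks (A : Set (Matrix (Fin n) (Fin n) ℂ))) r ∧
        r ∣ n ∧ (r = 1 ∨ r = 2) ∧
        (r = 1 → A = ⊤ ∨
          BurnsideType.IsSimilar (A : Set (Matrix (Fin n) (Fin n) ℂ))
            (Set.range fun Z : Matrix (Fin n) (Fin n) ℝ => Z.map (fun x : ℝ => (x : ℂ)))) ∧
        (r = 2 → ∃ h : n = n / 2 * 2,
          BurnsideType.IsSimilar (A : Set (Matrix (Fin n) (Fin n) ℂ))
            (Set.range (BurnsideType.blockMatrix h BurnsideType.quaternionToComplex)))) ∧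
    -- real algebras of quaternionic matrices
    (∀ A : NonUnitalSubalgebra ℝ (Matrix (Fin n) (Fin n) ℍ[ℝ]),
      BurnsideType.IsIrreducibleFamily (A : Set (Matrix (Fin n) (Fin n) ℍ[ℝ])) →
      ∃ r : ℕ, IsLeast (BurnsideType.nonzeroRanks (A : Set (Matrix (Fin n) (Fin n) ℍ[ℝ]))) r ∧
        r = 1 ∧
        (A = ⊤ ∨
          BurnsideType.IsSimilar (A : Set (Matrix (Fin n) (Fin n) ℍ[ℝ]))
            (Set.range fun Z : Matrix (Fin n) (Fin n) ℂ => Z.map (fun z : ℂ => (z : ℍ[ℝ]))) ∨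
          BurnsideType.IsSimilar (A : Set (Matrix (Fin n) (Fin n) ℍ[ℝ]))
            (Set.range fun Z : Matrix (Fin n) (Fin n) ℝ => Z.map (fun x : ℝ => (x : ℍ[ℝ]))))) := by
  refine ⟨fun A hA => ?_, fun A hA => ?_, fun A hA => ?_⟩
  -- The full algebra contains a rank-one matrix unit, which excludes `A = ⊤` when the least rank is
  -- 2 or 4.
  · have htop : ∀ d, IsLeast (BurnsideType.nonzeroRanks (A : Set (Matrix (Fin n) (Fin n) ℝ))) d →
        A = ⊤ → d ≤ 1 := fun d hd h => hd.2 (BurnsideType.isLeast_nonzeroRanks_one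
          (BurnsideType.isSimilar_refl _) ⟨0, hn⟩ (by simp [h])).1
    rcases BurnsideType.real_classification hn hA with ⟨h, hr⟩ | ⟨h, hs, hr⟩ | ⟨h, hs, hr⟩
    · exact ⟨1, hr, one_dvd n, by simp, fun _ => h, by simp, by simp, by simp [h]⟩
    · exact ⟨2, hr, ⟨n / 2, by rw [mul_comm, ← h]⟩, by simp, by simp, fun _ => ⟨h, hs⟩, by simp,
        ⟨fun h => absurd (htop 2 hr h) (by simp), by simp⟩⟩
    · exact ⟨4, hr, ⟨n / 4, by rw [mul_comm, ← h]⟩, by simp, by simp, by simp, fun _ => ⟨h, hs⟩,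
        ⟨fun h => absurd (htop 4 hr h) (by simp), by simp⟩⟩
  · rcases BurnsideType.complex_classification hn hA with ⟨h, hr⟩ | ⟨hs, hr⟩ | ⟨h, hs, hr⟩
    · exact ⟨1, hr, one_dvd n, by simp, fun _ => Or.inl h, by simp⟩
    · exact ⟨1, hr, one_dvd n, by simp, fun _ => Or.inr hs, by simp⟩
    · exact ⟨2, hr, ⟨n / 2, by rw [mul_comm, ← h]⟩, by simp, by simp, fun _ => ⟨h, hs⟩⟩
  · exact ⟨1, (BurnsideType.quaternion_classification hn hA).1, rfl,
      (BurnsideType.quaternion_classification hn hA).2⟩
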